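/- Let $a\ge 3$ be an integer, let $\rho$ be a root of the polynomial $x^3+(a-1)x^2-ax-1$, and let $K=\mathbb Q(\rho)$. Then $K$ has exactly three embeddings $\sigma_1,\sigma_2,\sigma_3$ into $\mathbb R$, which can be ordered so that $\sigma_1(\rho)>1$, $-1<\sigma_2(\rho)<0$ and $\sigma_3(\rho)<-1$; the signature of $\alpha\in K$ is the triple of signs of $\sigma_1(\alpha),\sigma_2(\alpha),\sigma_3(\alpha)$. For a signature $\mathfrak s$, an element $\alpha\in\mathbb Z[\rho]$ of signature $\mathfrak s$ is called $\mathfrak s$-indecomposable if it is not the sum of two elements of $\mathbb Z[\rho]$ that both have signature $\mathfrak s$. Put $$\kappa_s=1+s\rho+\rho^2\quad(1\le s\le a-1),$$ $$\lambda_{v,w}=-v-(a(v-1)+w)\rho+(a(v-1)+w+1)\rho^2\quad(1\le v\le a-1,\ \max\{1,v-1\}\le w\le a-1),$$ $$\mu_u=-1-u\rho+(u+2)\rho^2\quad(0\le u\le a-2),$$ where $s,v,w,u$ are integers. Then: 1. The indecomposables of signature $(+,+,+)$ in $\mathbb Z[\rho]$ are exactly the products of a totally positive unit of $\mathbb Z[\rho]$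 with $1$ or with one of the $\kappa_s$. 2. The indecomposables of signature $(+,-,+)$ in $\mathbb Z[\rho]$ are exactly the products of a totally positive unit of $\mathbb Z[\rho]$ with one of the $\lambda_{v,w}$ or one of the $\mu_u$. 3. For every signature $\mathfrak s$, the $\mathfrak s$-indecomposables of $\mathbb Z[\rho]$ are exactly the elements of signature $\mathfrak s$ that are products of a unit of $\mathbb Z[\rho]$ (of any signature) with one of $1$, $\kappa_s$, $\lambda_{v,w}$, $\mu_u$. 4. The signatures of the units of $\mathbb Z[\rho]$ are exactly $(+,+,+)$, $(-,-,-)$, $(+,-,-)$ and $(-,+,+)$; in particular, no product of a unit of $\mathbb Z[\rho]$ with a totally positive element has signature $(+,-,+)$. -/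

import Mathlib

/-- The signature of `α`: the tuple of the signs of its images under the embeddings `K → ℝ`.
It is meant for totally real `K`, where these are all the embeddings of `K`. -/
noncomputable def signature {K : Type*} [Field K] (α : K) : (K →+* ℝ) → SignType :=
  fun φ => SignType.sign (φ α)

/-- Totally positive elements: those of signature `(+, ..., +)`. -/
def IsTotPos {K : Type*} [Field K] (α : K) : Prop :=
  ∀ φ : K →+* ℝ, 0 < φ α

/-- `α` is an `s`-indecomposable element of the order `O`: it lies in `O`, it has signature `s`, and
it is not a sum of two elements of `O` that both have signature `s`. -/
def IsSIndecomposable {K : Type*} [Field K] (O : Subalgebra ℤ K)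
    (s : (K →+* ℝ) → SignType) (α : K) : Prop :=
  α ∈ O ∧ signature α = s ∧
    ¬ ∃ β γ : K, β ∈ O ∧ γ ∈ O ∧ signature β = s ∧ signature γ = s ∧ α = β + γ

/-- The order `ℤ[ρ]`. -/
def orderZ {K : Type*} [Field K] (ρ : K) : Subalgebra ℤ K := Algebra.adjoin ℤ {ρ}

/-- `κ_s = 1 + s ρ + ρ²`. -/
def ennolaKappa {K : Type*} [Field K] (ρ : K) (s : ℤ) : K :=
  1 + (s : K) * ρ + ρ ^ 2

/-- `λ_{v,w} = -v - (a (v - 1) + w) ρ + (a (v - 1) + w + 1) ρ²`. -/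
def ennolaLambda {K : Type*} [Field K] (a : ℤ) (ρ : K) (v w : ℤ) : K :=
  -(v : K) - ((a * (v - 1) + w : ℤ) : K) * ρ + ((a * (v - 1) + w + 1 : ℤ) : K) * ρ ^ 2

/-- `μ_u = -1 - u ρ + (u + 2) ρ²`. -/
def ennolaMu {K : Type*} [Field K] (ρ : K) (u : ℤ) : K :=
  -1 - (u : K) * ρ + ((u + 2 : ℤ) : K) * ρ ^ 2

/-- The elements `1` and `κ_s` with `1 ≤ s ≤ a - 1`. -/
def oneKappas {K : Type*} [Field K] (a : ℤ) (ρ : K) : Set K :=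
  {x | x = 1 ∨ ∃ s : ℤ, 1 ≤ s ∧ s ≤ a - 1 ∧ x = ennolaKappa ρ s}

/-- The elements `λ_{v,w}` with `1 ≤ v ≤ a - 1`, `max {1, v - 1} ≤ w ≤ a - 1`, and the elements
`μ_u` with `0 ≤ u ≤ a - 2`. -/
def lambdasMus {K : Type*} [Field K] (a : ℤ) (ρ : K) : Set K :=
  {x | (∃ v w : ℤ, 1 ≤ v ∧ v ≤ a - 1 ∧ max 1 (v - 1) ≤ w ∧ w ≤ a - 1 ∧
          x = ennolaLambda a ρ v w) ∨
       ∃ u : ℤ, 0 ≤ u ∧ u ≤ a - 2 ∧ x = ennolaMu ρ u}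

/-! Integral linear functionals that are positive on a whole signature do two jobs: they certify
indecomposability and they drive reduction modulo totally positive units. The units used are ρ², ρ +
a, its inverse ρ² - ρ, and κ_a = ρ²(ρ + a).

In coordinates x + yρ + zρ², the functionals a(x + z) - y and a(x + z) are positive on totally
positive elements and equal a on {1, ρ², κ_a} and on {1, ρ², ρ² - ρ} respectively. Minimising both
over an orbit (`exists_minimal`) and comparing with the neighbouring facets puts an associate into
the cone over one of these triples (`exists_mem_cone`). The second cone is unimodular; the first has
index a, and the κ_s represent the nontrivial classes.

For (+,-,+) the functionals 2(y + z) and y + z - x play the same role (`exists_mem_mixed_cone`). One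
cone lies over a lattice pentagon in y + z = 1; its integer decomposition property
(`InPentagon.exists_sub`) leaves only points of height 1, which are associates of the λ. The other
lies over a triangle, where a parity obstruction produces the μ. Conversely, y + z = 1 on λ cannot
be split into positive integers, while on κ and μ the only possible splitting 1 + 1 of x + z,
respectively y + z, is excluded by signs.

The units ±1, ±ρ carry every signature to one of these two. A unit of signature (+,-,+) would be
indecomposable because 1 is, hence an associate of some λ or μ; but those have norm below -1. -/

/-- `p > 1`, `-1 < q < 0` and `t < -1` are the real roots of `x³ + (a - 1) x² - a x - 1`. -/
structure EnnolaRoots (a : ℤ) (p q t : ℝ) : Prop where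
  le_a : 3 ≤ a
  root_p : p ^ 3 + ((a : ℝ) - 1) * p ^ 2 - a * p - 1 = 0
  root_q : q ^ 3 + ((a : ℝ) - 1) * q ^ 2 - a * q - 1 = 0
  root_t : t ^ 3 + ((a : ℝ) - 1) * t ^ 2 - a * t - 1 = 0
  one_lt_p : 1 < p
  neg_one_lt_q : -1 < q
  q_neg : q < 0
  t_lt : t < -1

theorem exists_ennolaRoots {a : ℤ} (ha : 3 ≤ a) : ∃ p q t : ℝ, EnnolaRoots a p q t := by
  have ha' : (3 : ℝ) ≤ a := by exact_mod_cast ha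
  let f : ℝ → ℝ := fun x => x ^ 3 + ((a : ℝ) - 1) * x ^ 2 - a * x - 1
  have hf : Continuous f := by fun_prop
  -- Since f(x) = x(x - 1)(x + a) - 1, the value at 1, 0 and -a is -1.
  obtain ⟨p, hp, hp'⟩ := intermediate_value_Ioo (by norm_num : (1 : ℝ) ≤ 2) hf.continuousOn
    (show (0 : ℝ) ∈ Set.Ioo (f 1) (f 2) by constructor <;> simp only [f] <;> linarith)
  obtain ⟨q, hq, hq'⟩ := intermediate_value_Ioo' (by norm_num : (-1 : ℝ) ≤ 0) hf.continuousOn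
    (show (0 : ℝ) ∈ Set.Ioo (f 0) (f (-1)) by constructor <;> simp only [f] <;> linarith)
  obtain ⟨t, ht, ht'⟩ := intermediate_value_Ioo (by linarith : (-a : ℝ) ≤ -1) hf.continuousOn
    (show (0 : ℝ) ∈ Set.Ioo (f (-a)) (f (-1)) by
      constructor <;> simp only [f]
      · nlinarith
      · linarith)
  exact ⟨p, q, t, ha, hp', hq', ht', hp.1, hq.1, hq.2, ht.2⟩

/-! ### Location of the roots and positive linear functionals -/

namespace EnnolaRoots

variable {a : ℤ} {p q t : ℝ}

theorem le_a_real (h : EnnolaRoots a p q t) : (3 : ℝ) ≤ a := by exact_mod_cast h.le_a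

theorem add_add (h : EnnolaRoots a p q t) : p + q + t = 1 - a := by
  have hp := h.one_lt_p
  have hq := h.neg_one_lt_q
  have hq' := h.q_neg
  have ht := h.t_lt
  have h1 : p ^ 2 + p * q + q ^ 2 + (a - 1) * (p + q) - a = 0 := by
    have : (p - q) * (p ^ 2 + p * q + q ^ 2 + (a - 1) * (p + q) - a) = 0 := by
      linear_combination h.root_p - h.root_q
    exact (mul_eq_zero.1 this).resolve_left (by linarith)
  have h2 : p ^ 2 + p * t + t ^ 2 + (a - 1) * (p + t) - a = 0 := by
    have : (p - t) * (p ^ 2 + p * t + t ^ 2 + (a - 1) * (p + t) - a) = 0 := by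
      linear_combination h.root_p - h.root_t
    exact (mul_eq_zero.1 this).resolve_left (by linarith)
  have h3 : (q - t) * (p + q + t + (a - 1)) = 0 := by linear_combination h1 - h2
  linarith [(mul_eq_zero.1 h3).resolve_left (by linarith)]

theorem mul_add_mul (h : EnnolaRoots a p q t) : p * q + p * t + q * t = -a := by
  have h1 : (p - q) * (p ^ 2 + p * q + q ^ 2 + (a - 1) * (p + q) - a) = 0 := by
    linear_combination h.root_p - h.root_q
  have h2 := (mul_eq_zero.1 h1).resolve_left (by linarith [h.one_lt_p, h.q_neg])
  linear_combination (p + q) * h.add_add - h2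

theorem mul_mul (h : EnnolaRoots a p q t) : p * q * t = 1 := by
  linear_combination h.root_p - p ^ 2 * h.add_add + p * h.mul_add_mul

/-- The polynomial is x(x - 1)(x + a) - 1, so ρ + a and ρ² - ρ are mutually inverse units. -/
theorem mul_p (h : EnnolaRoots a p q t) : (p ^ 2 - p) * (p + a) = 1 := by
  linear_combination h.root_p

theorem mul_q (h : EnnolaRoots a p q t) : (q ^ 2 - q) * (q + a) = 1 := by
  linear_combination h.root_q

theorem mul_t (h : EnnolaRoots a p q t) : (t ^ 2 - t) * (t + a) = 1 := by
  linear_combination h.root_t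

theorem neg_a_lt_t (h : EnnolaRoots a p q t) : -a < t := by
  have h1 := h.mul_t
  have h2 := h.t_lt
  by_contra hc
  nlinarith [mul_nonneg (by nlinarith : 0 ≤ t ^ 2 - t) (by linarith : 0 ≤ -(t + a))]

theorem q_gt (h : EnnolaRoots a p q t) : -1 / 2 < q := by
  have h1 := h.mul_q
  have h2 := h.q_neg
  have h3 := h.neg_one_lt_q
  have h4 := h.le_a_real
  by_contra hc
  have h5 : 3 / 4 ≤ q ^ 2 - q := by nlinarith
  nlinarith [mul_le_mul_of_nonneg_right h5 (by linarith : 0 ≤ q + a)]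

theorem t_lt' (h : EnnolaRoots a p q t) : t < 1 / 2 - a := by
  linarith [h.add_add, h.one_lt_p, h.q_gt]

theorem p_lt (h : EnnolaRoots a p q t) : p < 3 / 2 := by
  linarith [h.add_add, h.neg_a_lt_t, h.q_gt]

/-- A sign criterion for the linear functional with values `l₀, l₁, l₂` on the basis
`1, ρ, ρ²`. -/
theorem functional_pos (h : EnnolaRoots a p q t) {l₀ l₁ l₂ x y z : ℝ}
    (hp : 0 < (l₂ - l₁ * (q + t) + l₀ * (q * t)) * (x + y * p + z * p ^ 2))
    (hq : (l₂ - l₁ * (p + t) + l₀ * (p * t)) * (x + y * q + z * q ^ 2) < 0)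
    (ht : 0 < (l₂ - l₁ * (p + q) + l₀ * (p * q)) * (x + y * t + z * t ^ 2)) :
    0 < l₀ * x + l₁ * y + l₂ * z := by
  have h1 := h.one_lt_p
  have h2 := h.q_neg
  have h3 := h.neg_one_lt_q
  have h4 := h.t_lt
  have hD : 0 < (p - q) * (p - t) * (q - t) := by
    have : 0 < p - q := by linarith
    have : 0 < p - t := by linarith
    have : 0 < q - t := by linarith
    positivity
  -- Lagrange interpolation: each bracket is the functional applied to the product of the X - r over
  -- the other two roots r. The middle root contributes with the opposite sign.
  have key : (l₀ * x + l₁ * y + l₂ * z) * ((p - q) * (p - t) * (q - t)) =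
      (l₂ - l₁ * (q + t) + l₀ * (q * t)) * (x + y * p + z * p ^ 2) * (q - t)
      - (l₂ - l₁ * (p + t) + l₀ * (p * t)) * (x + y * q + z * q ^ 2) * (p - t)
      + (l₂ - l₁ * (p + q) + l₀ * (p * q)) * (x + y * t + z * t ^ 2) * (p - q) := by ring
  refine pos_of_mul_pos_left ?_ hD.le
  rw [key]
  have e1 := mul_pos hp (by linarith : 0 < q - t)
  have e2 := mul_neg_of_neg_of_pos hq (by linarith : 0 < p - t)
  have e3 := mul_pos ht (by linarith : 0 < p - q)
  linarith

theorem eq_zero_of_forall (h : EnnolaRoots a p q t) {x y z : ℝ} (hp : x + y * p + z * p ^ 2 = 0)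
    (hq : x + y * q + z * q ^ 2 = 0) (ht : x + y * t + z * t ^ 2 = 0) :
    x = 0 ∧ y = 0 ∧ z = 0 := by
  have h1 := h.one_lt_p
  have h2 := h.q_neg
  have h3 := h.neg_one_lt_q
  have h4 := h.t_lt
  have e1 : y + z * (p + q) = 0 := (mul_eq_zero.1 (by linear_combination hp - hq :
    (p - q) * (y + z * (p + q)) = 0)).resolve_left (by linarith)
  have e2 : y + z * (p + t) = 0 := (mul_eq_zero.1 (by linear_combination hp - ht :
    (p - t) * (y + z * (p + t)) = 0)).resolve_left (by linarith)
  have e3 : z = 0 := (mul_eq_zero.1 (by linear_combination e1 - e2 :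
    (q - t) * z = 0)).resolve_left (by linarith)
  subst e3
  have e4 : y = 0 := by linarith
  subst e4
  exact ⟨by linarith, rfl, rfl⟩

section TotallyPositive

variable {x y z : ℝ}

theorem add_pos_of_pos (h : EnnolaRoots a p q t) (hp : 0 < x + y * p + z * p ^ 2)
    (hq : 0 < x + y * q + z * q ^ 2) (ht : 0 < x + y * t + z * t ^ 2) : 0 < x + z := by
  have h1 := h.one_lt_p
  have h2 := h.q_neg
  have h3 := h.neg_one_lt_q
  have h4 := h.t_lt
  have := h.functional_pos (l₀ := 1) (l₁ := 0) (l₂ := 1)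
    (mul_pos (by nlinarith) hp) (mul_neg_of_neg_of_pos (by nlinarith) hq)
    (mul_pos (by nlinarith [h.p_lt, h.q_gt]) ht)
  linarith

theorem mul_sub_pos_of_pos (h : EnnolaRoots a p q t) (hp : 0 < x + y * p + z * p ^ 2)
    (hq : 0 < x + y * q + z * q ^ 2) (ht : 0 < x + y * t + z * t ^ 2) : 0 < a * (x + z) - y := by
  have h1 := h.one_lt_p
  have h2 := h.q_neg
  have h3 := h.q_gt
  have h4 := h.t_lt'
  have h5 := h.p_lt
  have h6 := h.le_a_real
  have hs := h.add_add
  have hm := h.mul_mul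
  have c1 : 0 < a - (-1) * (q + t) + a * (q * t) := by
    have : 0 < q * t := by nlinarith
    nlinarith
  have c2 : a - (-1) * (p + t) + a * (p * t) < 0 := by
    have : p * t < -5 / 2 := by nlinarith
    nlinarith
  have c3 : 0 < a - (-1) * (p + q) + a * (p * q) := by
    have h7 : -a < t := h.neg_a_lt_t
    -- Multiplying by -t > 0 and using Vieta leaves an expression in t alone.
    have h8 : (a - (-1) * (p + q) + a * (p * q)) * (-t) = t ^ 2 - t - a := by
      linear_combination (-t) * hs - a * hm
    have h9 : 0 < (a - (-1) * (p + q) + a * (p * q)) * (-t) := by rw [h8]; nlinarith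
    exact pos_of_mul_pos_left h9 (by linarith)
  have := h.functional_pos (l₀ := a) (l₁ := -1) (l₂ := a)
    (mul_pos c1 hp) (mul_neg_of_neg_of_pos c2 hq) (mul_pos c3 ht)
  linarith

end TotallyPositive

section Mixed

variable {x y z : ℝ}

theorem add_pos_of_mixed (h : EnnolaRoots a p q t) (hp : 0 < x + y * p + z * p ^ 2)
    (hq : x + y * q + z * q ^ 2 < 0) (ht : 0 < x + y * t + z * t ^ 2) : 0 < y + z := by
  have := h.functional_pos (l₀ := 0) (l₁ := 1) (l₂ := 1)
    (mul_pos (by linarith [h.q_neg, h.t_lt]) hp)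
    (mul_neg_of_pos_of_neg (by linarith [h.p_lt, h.t_lt]) hq)
    (mul_pos (by linarith [h.add_add, h.neg_a_lt_t]) ht)
  linarith

theorem add_sub_pos_of_mixed (h : EnnolaRoots a p q t) (hp : 0 < x + y * p + z * p ^ 2)
    (hq : x + y * q + z * q ^ 2 < 0) (ht : 0 < x + y * t + z * t ^ 2) : 0 < y + z - x := by
  have h1 := h.one_lt_p
  have h2 := h.q_neg
  have h3 := h.q_gt
  have h4 := h.t_lt'
  have h5 := h.p_lt
  have h6 := h.le_a_real
  have hs := h.add_add
  have hm := h.mul_mul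
  have := h.functional_pos (l₀ := -1) (l₁ := 1) (l₂ := 1)
    (mul_pos (by nlinarith [mul_pos_of_neg_of_neg h2 (by linarith : t < 0)]) hp)
    (mul_neg_of_pos_of_neg (by nlinarith) hq)
    (mul_pos (by nlinarith [h.neg_a_lt_t]) ht)
  linarith

end Mixed

/-- The three values of `λ`-type elements `ρ² - v + N (ρ² - ρ)`. -/
theorem lambda_signs (h : EnnolaRoots a p q t) {v w : ℤ} (hv : 1 ≤ v) (hva : v ≤ a - 1)
    (hw : v - 1 ≤ w) (hwa : w ≤ a - 1) :
    0 < p ^ 2 - v + (a * (v - 1) + w) * (p ^ 2 - p) ∧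
    q ^ 2 - v + (a * (v - 1) + w) * (q ^ 2 - q) < 0 ∧
    0 < t ^ 2 - v + (a * (v - 1) + w) * (t ^ 2 - t) := by
  have h1 := h.one_lt_p
  have h2 := h.q_neg
  have h3 := h.q_gt
  have h4 := h.t_lt'
  have h5 := h.p_lt
  have h6 := h.le_a_real
  have v1 : (1 : ℝ) ≤ v := by exact_mod_cast hv
  have v2 : (v : ℝ) ≤ a - 1 := by exact_mod_cast hva
  have w1 : (v : ℝ) - 1 ≤ w := by exact_mod_cast hw
  have w2 : (w : ℝ) ≤ a - 1 := by exact_mod_cast hwa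
  refine ⟨?_, ?_, ?_⟩
  -- Multiplying by p + a, the inverse of p² - p, turns the large coefficient into a constant term.
  · refine pos_of_mul_pos_left (b := p + a) ?_ (by linarith)
    have e : (p ^ 2 - v + (a * (v - 1) + w) * (p ^ 2 - p)) * (p + a) =
      (p ^ 2 - v) * (p + a) + (a * (v - 1) + w) := by
      linear_combination (a * (v - 1) + w : ℝ) * h.mul_p
    rw [e]
    -- This is the value at w = v - 1, the smallest w allowed.
    have : 0 < (p - 1) * ((p + 1) * (p + a) - (v - 1)) :=
      mul_pos (by linarith) (by nlinarith)
    nlinarith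
  · refine neg_of_mul_neg_left (b := q + a) ?_ (by linarith)
    have e : (q ^ 2 - v + (a * (v - 1) + w) * (q ^ 2 - q)) * (q + a) =
      (q ^ 2 - v) * (q + a) + (a * (v - 1) + w) := by
      linear_combination (a * (v - 1) + w : ℝ) * h.mul_q
    rw [e]
    have e2 : (1 - q) * (q ^ 2 * (q + a)) = -q := by linear_combination -q * h.mul_q
    have e3 : (q ^ 2 - q) * (v + q + 1) ≤ (q ^ 2 - q) * (q + a) :=
      mul_le_mul_of_nonneg_left (by linarith) (by nlinarith)
    rw [h.mul_q] at e3
    have : (1 - q) * ((q ^ 2 - v) * (q + a) + (a * (v - 1) + w)) < 0 := by nlinarith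
    exact neg_of_mul_neg_right this (by linarith)
  · have e1 : 1 < t ^ 2 := by nlinarith
    have e2 : 1 < t ^ 2 - t := by nlinarith
    have e3 : (v : ℝ) - 1 ≤ a * (v - 1) + w := by nlinarith
    nlinarith [mul_le_mul e3 e2.le (by norm_num) (by linarith)]

/-- The three values of `μ_u`. -/
theorem mu_signs (h : EnnolaRoots a p q t) {u : ℤ} (hu : 0 ≤ u) (hua : u ≤ a - 2) :
    0 < 2 * p ^ 2 - 1 + u * (p ^ 2 - p) ∧ 2 * q ^ 2 - 1 + u * (q ^ 2 - q) < 0 ∧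
    0 < 2 * t ^ 2 - 1 + u * (t ^ 2 - t) := by
  have h1 := h.one_lt_p
  have h2 := h.q_neg
  have h3 := h.q_gt
  have h4 := h.t_lt'
  have h5 := h.p_lt
  have h6 := h.le_a_real
  have u1 : (0 : ℝ) ≤ u := by exact_mod_cast hu
  have u2 : (u : ℝ) ≤ a - 2 := by exact_mod_cast hua
  refine ⟨?_, ?_, ?_⟩
  · nlinarith [mul_nonneg u1 (by nlinarith : 0 ≤ p ^ 2 - p)]
  · refine neg_of_mul_neg_left (b := q + a) ?_ (by linarith)
    have e : (2 * q ^ 2 - 1 + u * (q ^ 2 - q)) * (q + a) =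
      (2 * q ^ 2 - 1) * (q + a) + u := by linear_combination (u : ℝ) * h.mul_q
    rw [e]
    have e2 : (1 - q) * (q ^ 2 * (q + a)) = -q := by linear_combination -q * h.mul_q
    have : (1 - q) * ((2 * q ^ 2 - 1) * (q + a) + u) < 0 := by nlinarith
    exact neg_of_mul_neg_right this (by linarith)
  · nlinarith [mul_nonneg u1 (by nlinarith : 0 ≤ t ^ 2 - t)]

end EnnolaRoots

/-! ### The norm form, and norms of λ and μ -/

/-- The norm of `x + y ρ + z ρ²`. -/
def ennolaNorm (a x y z : ℤ) : ℤ :=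
  x ^ 3 + y ^ 3 + z ^ 3 + (1 - a) * (x ^ 2 * y) + ((1 - a) ^ 2 + 2 * a) * (x ^ 2 * z)
    - a * (x * y ^ 2) + (a ^ 2 - 2 * (1 - a)) * (x * z ^ 2) + (1 - a) * (y ^ 2 * z)
    - a * (y * z ^ 2) + (-(a * (1 - a)) - 3) * (x * y * z)

theorem EnnolaRoots.prod_eq_norm {a : ℤ} {p q t : ℝ} (h : EnnolaRoots a p q t) (x y z : ℤ) :
    (x + y * p + z * p ^ 2) * (x + y * q + z * q ^ 2) * (x + y * t + z * t ^ 2) =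
      ennolaNorm a x y z := by
  -- A real variable in place of the cast of a, so that the trace relation can eliminate it.
  obtain ⟨A, hA⟩ : ∃ A : ℝ, A = a := ⟨_, rfl⟩
  have h1 := h.add_add
  have h2 := h.mul_add_mul
  have h3 := h.mul_mul
  rw [← hA] at h1 h2
  simp only [ennolaNorm]
  push_cast
  rw [← hA]
  obtain rfl : A = 1 - (p + q + t) := by linarith
  have s1 : p ^ 2 + q ^ 2 + t ^ 2 = (p + q + t) ^ 2 - 2 * (p * q + p * t + q * t) := by ring
  have key : (x + y * p + z * p ^ 2) * (x + y * q + z * q ^ 2) * (x + y * t + z * t ^ 2) =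
      x ^ 3 + (p * q * t) * y ^ 3 + (p * q * t) ^ 2 * z ^ 3 + x ^ 2 * y * (p + q + t)
      + x ^ 2 * z * ((p + q + t) ^ 2 - 2 * (p * q + p * t + q * t))
      + x * y ^ 2 * (p * q + p * t + q * t)
      + x * z ^ 2 * ((p * q + p * t + q * t) ^ 2 - 2 * ((p + q + t) * (p * q * t)))
      + y ^ 2 * z * ((p + q + t) * (p * q * t)) + y * z ^ 2 * ((p * q + p * t + q * t) * (p * q * t))
      + x * y * z * ((p + q + t) * (p * q + p * t + q * t) - 3 * (p * q * t)) := by ring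
  rw [key, h2, h3]
  ring

/-- Measured by the slacks i, j, k in the constraints, minus the norm is 1 plus a polynomial with
nonnegative coefficients. The bound a ≥ 3 excludes the point where all slacks vanish, at which the
norm is -1. -/
theorem ennolaNorm_lambda_lt {a v w : ℤ} (ha : 3 ≤ a) (hv : 1 ≤ v) (hva : v ≤ a - 1)
    (hw : v - 1 ≤ w) (hwa : w ≤ a - 1) :
    ennolaNorm a (-v) (-(a * (v - 1) + w)) (a * (v - 1) + w + 1) < -1 := by
  obtain ⟨i, rfl⟩ : ∃ i, v = 1 + i := ⟨v - 1, by ring⟩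
  simp only [ennolaNorm]
  rcases hw.eq_or_lt with hw | hw
  · obtain rfl : w = i := by linarith
    obtain ⟨k, rfl⟩ : ∃ k, a = w + k + 2 := ⟨a - w - 2, by ring⟩
    have hi : 0 ≤ w := by linarith
    have hk : 0 ≤ k := by linarith
    have : 0 ≤ w ^ 2 * k + w ^ 2 + 2 * w * k ^ 2 + 9 * w * k + 6 * w + k := by positivity
    linarith
  · obtain ⟨j, rfl⟩ : ∃ j, w = i + j + 1 := ⟨w - i - 1, by ring⟩
    obtain ⟨k, rfl⟩ : ∃ k, a = i + j + k + 2 := ⟨a - i - j - 2, by ring⟩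
    have hi : 0 ≤ i := by linarith
    have hj : 0 ≤ j := by linarith
    have hk : 0 ≤ k := by linarith
    have : 0 ≤ i ^ 2 * j * k + 2 * i ^ 2 * k + i * j ^ 2 * k + i * j ^ 2 + i * j * k ^ 2
      + 7 * i * j * k + 3 * i * j + 3 * i * k ^ 2 + 11 * i * k + i + j ^ 2 * k + j ^ 2
      + 5 * j * k + 2 * j + 5 * k := by positivity
    linarith

theorem ennolaNorm_mu_lt {a u : ℤ} (hu : 0 ≤ u) (hua : u ≤ a - 2) :
    ennolaNorm a (-1) (-u) (u + 2) < -1 := by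
  obtain ⟨j, rfl⟩ : ∃ j, a = u + j + 2 := ⟨a - u - 2, by ring⟩
  have hj : 0 ≤ j := by linarith
  simp only [ennolaNorm]
  have : 0 ≤ 2 * u ^ 2 * j + 4 * u ^ 2 + u * j ^ 2 + 13 * u * j + 16 * u + 2 * j ^ 2 + 16 * j := by
    positivity
  linarith

/-! ### Integer decomposition of the pentagon -/

/-- The lattice points `(i, W)` of the `n`-fold dilate of the pentagon whose lattice points
parametrize the elements `λ` (and some of their translates). -/
def InPentagon (a n i W : ℤ) : Prop :=
  0 ≤ i ∧ 0 ≤ W ∧ W ≤ (a - 1) * n ∧ i - n ≤ W ∧ i + W ≤ (2 * a - 3) * n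

/-- Here s - ⌊s/n⌋ = ⌈s(n - 1)/n⌉, so flooring leaves a remainder that fits the (n - 1)-fold dilate;
the same formula gives monotonicity in s. -/
theorem Int.sub_ediv_le_of_le_mul {n b s : ℤ} (hn : 0 < n) (h : s ≤ b * n) :
    s - s / n ≤ b * (n - 1) := by
  have h1 := Int.mul_ediv_add_emod s n
  have h2 := Int.emod_lt_of_pos s hn
  have h3 := Int.emod_nonneg s hn.ne'
  set d := s / n
  set r := s % n
  rcases le_or_gt b d with hd | hd
  · have : 0 ≤ (d - b) * n := by nlinarith
    have : (d - b) * (n - 1) + r ≤ 0 := by nlinarith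
    nlinarith
  · nlinarith [mul_nonneg (by linarith : 0 ≤ b - d - 1) (by linarith : 0 ≤ n - 1)]

theorem Int.sub_ediv_mono {n s t : ℤ} (hn : 0 < n) (h : s ≤ t) : s - s / n ≤ t - t / n := by
  have h1 := Int.mul_ediv_add_emod s n
  have h2 := Int.emod_lt_of_pos s hn
  have h3 := Int.emod_nonneg s hn.ne'
  have h1' := Int.mul_ediv_add_emod t n
  have h2' := Int.emod_lt_of_pos t hn
  have h3' := Int.emod_nonneg t hn.ne'
  have hd := Int.ediv_le_ediv hn h
  set d := s / n
  set d' := t / n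
  rcases hd.eq_or_lt with hd | hd
  · omega
  · nlinarith [mul_nonneg (by linarith : 0 ≤ d' - d - 1) (by linarith : 0 ≤ n - 1)]

/-- The integer decomposition property of the pentagon. -/
theorem InPentagon.exists_sub {a n i W : ℤ} (ha : 3 ≤ a) (hn : 2 ≤ n) (h : InPentagon a n i W) :
    ∃ i₀ W₀, InPentagon a 1 i₀ W₀ ∧ InPentagon a (n - 1) (i - i₀) (W - W₀) := by
  obtain ⟨h1, h2, h3, h4, h5⟩ := h
  have hn0 : 0 < n := by linarith
  -- The corner triangle with vertices (a-2, a-2), (a-1, a-2), (a-2, a-1) is unimodular: inside its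
  -- dilate one subtracts a vertex. Elsewhere rounding works.
  by_cases hT : (a - 2) * n ≤ i ∧ (a - 2) * n ≤ W
  · obtain ⟨hi, hW⟩ := hT
    have hX : 0 ≤ (a - 2) * (n - 1) := mul_nonneg (by linarith) (by linarith)
    rcases hi.eq_or_lt with hi | hi
    · rcases hW.eq_or_lt with hW | hW
      · refine ⟨a - 2, a - 2, ⟨?_, ?_, ?_, ?_, ?_⟩, ⟨?_, ?_, ?_, ?_, ?_⟩⟩ <;> linarith
      · refine ⟨a - 2, a - 1, ⟨?_, ?_, ?_, ?_, ?_⟩, ⟨?_, ?_, ?_, ?_, ?_⟩⟩ <;> linarith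
    · refine ⟨a - 1, a - 2, ⟨?_, ?_, ?_, ?_, ?_⟩, ⟨?_, ?_, ?_, ?_, ?_⟩⟩ <;> linarith
  · rcases le_or_gt i W with hiW | hiW
    -- On and above the diagonal, flooring both coordinates respects 0 ≤ i ≤ W and the upper bounds,
    -- hence also the bound on i + W.
    · have hi : i ≤ (a - 2) * n := by
        by_contra hc
        exact hT ⟨by linarith, by linarith⟩
      have b1 : i / n ≤ a - 2 := by
        simpa using Int.ediv_le_of_le_mul hn0 hi
      have b2 : W / n ≤ a - 1 := by
        simpa using Int.ediv_le_of_le_mul hn0 h3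
      have b3 : 0 ≤ i / n := Int.ediv_nonneg h1 hn0.le
      have b4 : i / n ≤ W / n := Int.ediv_le_ediv hn0 hiW
      have c1 := Int.sub_ediv_le_of_le_mul hn0 hi
      have c2 := Int.sub_ediv_le_of_le_mul hn0 h3
      have c3 := Int.sub_ediv_mono hn0 h1
      have c4 := Int.sub_ediv_mono hn0 hiW
      simp only [Int.zero_ediv, sub_zero] at c3
      refine ⟨i / n, W / n, ⟨?_, ?_, ?_, ?_, ?_⟩, ⟨?_, ?_, ?_, ?_, ?_⟩⟩ <;> linarith
    -- Below the diagonal W < i ≤ W + n, and the subtracted point is taken on the edge i₀ = W₀ + 1.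
    · have hW : W ≤ (a - 2) * n := by
        by_contra hc
        exact hT ⟨by linarith, by linarith⟩
      have b1 : W / n ≤ a - 2 := by
        simpa using Int.ediv_le_of_le_mul hn0 hW
      have b3 : 0 ≤ W / n := Int.ediv_nonneg h2 hn0.le
      have c1 := Int.sub_ediv_le_of_le_mul hn0 hW
      have c3 := Int.sub_ediv_mono hn0 h2
      simp only [Int.zero_ediv, sub_zero] at c3
      refine ⟨W / n + 1, W / n, ⟨?_, ?_, ?_, ?_, ?_⟩, ⟨?_, ?_, ?_, ?_, ?_⟩⟩ <;> linarith

/-! ### Signatures and total positivity -/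

section Signature

variable {K : Type*} [Field K]

theorem signature_mul (α β : K) : signature (α * β) = signature α * signature β := by
  funext φ
  simp [signature, sign_mul]

theorem signature_one : signature (1 : K) = 1 := by
  funext φ
  simp [signature]

theorem signature_mul_self {α : K} (h : α ≠ 0) : signature α * signature α = 1 := by
  funext φ
  have h1 : φ α ≠ 0 := (map_ne_zero φ).2 h
  have h2 : 0 < φ α * φ α := mul_self_pos.2 h1
  simp [signature, ← sign_mul, h2]

theorem signature_add {α β : K} (h : signature α = signature β) :
    signature (α + β) = signature α := by
  funext φ
  have h1 := congrFun h φ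
  simp only [signature] at h1 ⊢
  rw [map_add]
  rcases lt_trichotomy (φ α) 0 with h2 | h2 | h2
  · have h3 : φ β < 0 := by rwa [sign_neg h2, eq_comm, sign_eq_neg_one_iff] at h1
    rw [sign_neg h2, sign_neg (by linarith)]
  · have h3 : φ β = 0 := by rwa [h2, sign_zero, eq_comm, sign_eq_zero_iff] at h1
    rw [h2, h3, add_zero]
  · have h3 : 0 < φ β := by rwa [sign_pos h2, eq_comm, sign_eq_one_iff] at h1
    rw [sign_pos h2, sign_pos (by linarith)]

theorem isTotPos_iff_signature {α : K} : IsTotPos α ↔ signature α = 1 := by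
  rw [funext_iff]
  exact forall_congr' fun φ => sign_eq_one_iff.symm

theorem IsTotPos.add {α β : K} (hα : IsTotPos α) (hβ : IsTotPos β) : IsTotPos (α + β) :=
  fun φ => by simpa using add_pos (hα φ) (hβ φ)

theorem IsTotPos.mul {α β : K} (hα : IsTotPos α) (hβ : IsTotPos β) : IsTotPos (α * β) :=
  fun φ => by simpa using mul_pos (hα φ) (hβ φ)

theorem IsTotPos.inv {α : K} (hα : IsTotPos α) : IsTotPos α⁻¹ :=
  fun φ => by simpa using hα φ

theorem isTotPos_one : IsTotPos (1 : K) := fun φ => by simp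

theorem IsTotPos.signature_mul {α β : K} (hα : IsTotPos α) : signature (α * β) = signature β := by
  rw [_root_.signature_mul, isTotPos_iff_signature.1 hα, one_mul]

theorem signature_eq_comp_symm_iff (σ : Fin 3 ≃ (K →+* ℝ)) (s : Fin 3 → SignType) (α : K) :
    signature α = s ∘ σ.symm ↔ ∀ i, SignType.sign (σ i α) = s i := by
  rw [funext_iff, ← σ.forall_congr_right]
  simp [signature]

theorem isTotPos_iff (σ : Fin 3 ≃ (K →+* ℝ)) {α : K} :
    IsTotPos α ↔ 0 < σ 0 α ∧ 0 < σ 1 α ∧ 0 < σ 2 α := by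
  rw [IsTotPos, ← σ.forall_congr_right, Fin.forall_fin_succ, Fin.forall_fin_two]
  rfl

theorem signature_eq_positive_iff (σ : Fin 3 ≃ (K →+* ℝ)) {α : K} :
    signature α = (![1, 1, 1] : Fin 3 → SignType) ∘ σ.symm ↔ IsTotPos α := by
  rw [signature_eq_comp_symm_iff, isTotPos_iff σ, Fin.forall_fin_succ, Fin.forall_fin_two]
  simp [sign_eq_one_iff]

theorem signature_eq_mixed_iff (σ : Fin 3 ≃ (K →+* ℝ)) {α : K} :
    signature α = (![1, -1, 1] : Fin 3 → SignType) ∘ σ.symm ↔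
      0 < σ 0 α ∧ σ 1 α < 0 ∧ 0 < σ 2 α := by
  rw [signature_eq_comp_symm_iff, Fin.forall_fin_succ, Fin.forall_fin_two]
  simp [sign_eq_one_iff, sign_eq_neg_one_iff]

end Signature

/-! ### Units of the order -/

section OrderUnit

variable {K : Type*} [Field K] {ρ : K}

/-- The nonzero elements of `K` that are units of `ℤ[ρ]`. -/
def IsOrderUnit (ρ ε : K) : Prop := ε ∈ orderZ ρ ∧ ε⁻¹ ∈ orderZ ρ ∧ ε ≠ 0

theorem IsOrderUnit.mul {ε η : K} (hε : IsOrderUnit ρ ε) (hη : IsOrderUnit ρ η) :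
    IsOrderUnit ρ (ε * η) :=
  ⟨mul_mem hε.1 hη.1, by rw [mul_inv]; exact mul_mem hε.2.1 hη.2.1, mul_ne_zero hε.2.2 hη.2.2⟩

theorem IsOrderUnit.inv {ε : K} (hε : IsOrderUnit ρ ε) : IsOrderUnit ρ ε⁻¹ :=
  ⟨hε.2.1, by rw [inv_inv]; exact hε.1, inv_ne_zero hε.2.2⟩

theorem IsOrderUnit.neg {ε : K} (hε : IsOrderUnit ρ ε) : IsOrderUnit ρ (-ε) :=
  ⟨neg_mem hε.1, by rw [inv_neg]; exact neg_mem hε.2.1, neg_ne_zero.2 hε.2.2⟩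

theorem isOrderUnit_one : IsOrderUnit ρ 1 :=
  ⟨one_mem _, by rw [inv_one]; exact one_mem _, one_ne_zero⟩

theorem IsOrderUnit.of_mul_eq_one {ε η : K} (hε : ε ∈ orderZ ρ) (hη : η ∈ orderZ ρ)
    (h : ε * η = 1) : IsOrderUnit ρ ε :=
  ⟨hε, by rwa [inv_eq_of_mul_eq_one_right h], left_ne_zero_of_mul_eq_one h⟩

theorem isOrderUnit_coe (u : (orderZ ρ)ˣ) : IsOrderUnit ρ ((u : orderZ ρ) : K) :=
  .of_mul_eq_one (u : orderZ ρ).2 ((u⁻¹ : (orderZ ρ)ˣ) : orderZ ρ).2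
    (by rw [← MulMemClass.coe_mul, Units.mul_inv, OneMemClass.coe_one])

theorem exists_units_iff {P : K → Prop} :
    (∃ u : (orderZ ρ)ˣ, P ((u : orderZ ρ) : K)) ↔ ∃ ε, IsOrderUnit ρ ε ∧ P ε := by
  refine ⟨fun ⟨u, hu⟩ => ⟨_, isOrderUnit_coe u, hu⟩, fun ⟨ε, hε, hP⟩ => ?_⟩
  exact ⟨⟨⟨ε, hε.1⟩, ⟨ε⁻¹, hε.2.1⟩, Subtype.ext (mul_inv_cancel₀ hε.2.2),
    Subtype.ext (inv_mul_cancel₀ hε.2.2)⟩, hP⟩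

/-- Multiplication by ε is an additive bijection of the order that shifts all signatures by that of
ε. -/
theorem IsSIndecomposable.unit_mul {s : (K →+* ℝ) → SignType} {α ε : K} (hε : IsOrderUnit ρ ε)
    (h : IsSIndecomposable (orderZ ρ) s α) :
    IsSIndecomposable (orderZ ρ) (signature ε * s) (ε * α) := by
  obtain ⟨h1, h2, h3⟩ := h
  refine ⟨mul_mem hε.1 h1, by rw [signature_mul, h2], ?_⟩
  rintro ⟨β, γ, hβ, hγ, sβ, sγ, e⟩
  have hs : ∀ δ, signature δ = signature ε * s → signature (ε⁻¹ * δ) = s := by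
    intro δ hδ
    rw [signature_mul, hδ, ← mul_assoc, ← signature_mul, inv_mul_cancel₀ hε.2.2, signature_one,
      one_mul]
  exact h3 ⟨ε⁻¹ * β, ε⁻¹ * γ, mul_mem hε.2.1 hβ, mul_mem hε.2.1 hγ, hs β sβ, hs γ sγ, by
    rw [← mul_add, ← e, inv_mul_cancel_left₀ hε.2.2]⟩

theorem IsSIndecomposable.tp_unit_mul {s : (K →+* ℝ) → SignType} {α ε : K}
    (hε : IsOrderUnit ρ ε) (hp : IsTotPos ε) (h : IsSIndecomposable (orderZ ρ) s α) :
    IsSIndecomposable (orderZ ρ) s (ε * α) := by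
  simpa [isTotPos_iff_signature.1 hp] using h.unit_mul hε

/-- The totally positive units of `ℤ[ρ]`. -/
def IsTPUnit (ρ ε : K) : Prop := IsOrderUnit ρ ε ∧ IsTotPos ε

theorem IsTPUnit.mul {ε η : K} (hε : IsTPUnit ρ ε) (hη : IsTPUnit ρ η) : IsTPUnit ρ (ε * η) :=
  ⟨hε.1.mul hη.1, hε.2.mul hη.2⟩

theorem IsTPUnit.inv {ε : K} (hε : IsTPUnit ρ ε) : IsTPUnit ρ ε⁻¹ := ⟨hε.1.inv, hε.2.inv⟩

theorem isTPUnit_one : IsTPUnit ρ 1 := ⟨isOrderUnit_one, isTotPos_one⟩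

theorem IsTPUnit.of_mul_eq_one {ε η : K} (hε : IsTPUnit ρ ε) (h : ε * η = 1) : IsTPUnit ρ η := by
  rw [← inv_eq_of_mul_eq_one_right h]
  exact hε.inv

end OrderUnit

/-! ### Coordinates, and minimisation over unit orbits -/

section Coordinates

variable {K : Type*} [Field K] {ρ : K} {a : ℤ}

/-- The element `x + y ρ + z ρ²`. -/
def ofCoords (ρ : K) (x y z : ℤ) : K := x + y * ρ + z * ρ ^ 2

theorem ofCoords_add (x y z x' y' z' : ℤ) :
    ofCoords ρ x y z + ofCoords ρ x' y' z' = ofCoords ρ (x + x') (y + y') (z + z') := by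
  simp only [ofCoords]
  push_cast
  ring

theorem ofCoords_mul (hρ : ρ ^ 3 + ((a : K) - 1) * ρ ^ 2 - (a : K) * ρ - 1 = 0)
    (x y z x' y' z' : ℤ) :
    ofCoords ρ x y z * ofCoords ρ x' y' z' = ofCoords ρ
      (x * x' + (y * z' + z * y') - (a - 1) * (z * z'))
      (x * y' + y * x' + a * (y * z' + z * y') + (1 - a * (a - 1)) * (z * z'))
      (x * z' + y * y' + z * x' - (a - 1) * (y * z' + z * y') + (a + (a - 1) ^ 2) * (z * z')) := by
  simp only [ofCoords]
  push_cast
  linear_combination ((y * z' + z * y' : K) + z * z' * (ρ - (a - 1))) * hρ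

theorem ofCoords_mem (x y z : ℤ) : ofCoords ρ x y z ∈ orderZ ρ := by
  have h : ρ ∈ orderZ ρ := Algebra.self_mem_adjoin_singleton ℤ ρ
  exact add_mem (add_mem (intCast_mem _ x) (mul_mem (intCast_mem _ y) h))
    (mul_mem (intCast_mem _ z) (pow_mem h 2))

theorem exists_ofCoords (hρ : ρ ^ 3 + ((a : K) - 1) * ρ ^ 2 - (a : K) * ρ - 1 = 0) {α : K}
    (h : α ∈ orderZ ρ) : ∃ x y z, α = ofCoords ρ x y z := by
  induction h using Algebra.adjoin_induction with
  | mem x hx =>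
    obtain rfl : x = ρ := hx
    exact ⟨0, 1, 0, by simp [ofCoords]⟩
  | algebraMap r => exact ⟨r, 0, 0, by simp [ofCoords]⟩
  | add α β _ _ hα hβ =>
    obtain ⟨x, y, z, rfl⟩ := hα
    obtain ⟨x', y', z', rfl⟩ := hβ
    exact ⟨_, _, _, ofCoords_add ..⟩
  | mul α β _ _ hα hβ =>
    obtain ⟨x, y, z, rfl⟩ := hα
    obtain ⟨x', y', z', rfl⟩ := hβ
    exact ⟨_, _, _, ofCoords_mul hρ ..⟩

theorem map_ofCoords (φ : K →+* ℝ) (x y z : ℤ) :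
    φ (ofCoords ρ x y z) = x + y * φ ρ + z * φ ρ ^ 2 := by
  simp [ofCoords]

theorem ennolaKappa_eq (s : ℤ) : ennolaKappa ρ s = ofCoords ρ 1 s 1 := by
  simp [ennolaKappa, ofCoords]

theorem ennolaLambda_eq (v w : ℤ) : ennolaLambda a ρ v w =
    ofCoords ρ (-v) (-(a * (v - 1) + w)) (a * (v - 1) + w + 1) := by
  simp only [ennolaLambda, ofCoords]
  push_cast
  ring

theorem ennolaMu_eq (u : ℤ) : ennolaMu ρ u = ofCoords ρ (-1) (-u) (u + 2) := by
  simp only [ennolaMu, ofCoords]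
  push_cast
  ring

theorem ofCoords_one : ofCoords ρ 1 0 0 = 1 := by simp [ofCoords]

/-- A function on a set stable under totally positive units attains its minimum on orbits. -/
theorem exists_minimal (hρ : ρ ^ 3 + ((a : K) - 1) * ρ ^ 2 - (a : K) * ρ - 1 = 0) {P : K → Prop}
    (hP : ∀ ε α, IsTPUnit ρ ε → P α → P (ε * α)) (f g : ℤ → ℤ → ℤ → ℤ)
    (hf : ∀ x y z, P (ofCoords ρ x y z) → 0 < f x y z ∧ 0 < g x y z)
    {α : K} (hα : α ∈ orderZ ρ) (hPα : P α) :
    ∃ ε x y z, IsTPUnit ρ ε ∧ ε * α = ofCoords ρ x y z ∧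
      ((∀ ε' x' y' z', IsTPUnit ρ ε' → ε' * ofCoords ρ x y z = ofCoords ρ x' y' z' →
          f x y z ≤ f x' y' z' ∧ f x y z ≤ g x' y' z') ∨
       (∀ ε' x' y' z', IsTPUnit ρ ε' → ε' * ofCoords ρ x y z = ofCoords ρ x' y' z' →
          g x y z ≤ f x' y' z' ∧ g x y z ≤ g x' y' z')) := by
  -- The values of f and g share one set, so its least element bounds both functions on the whole
  -- orbit, whichever of them attains it.
  let S : Set ℕ := {m | ∃ ε x y z, IsTPUnit ρ ε ∧ ε * α = ofCoords ρ x y z ∧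
    ((m : ℤ) = f x y z ∨ (m : ℤ) = g x y z)}
  have hpos : ∀ ε x y z, IsTPUnit ρ ε → ε * α = ofCoords ρ x y z →
      0 < f x y z ∧ 0 < g x y z := by
    intro ε x y z hε h
    exact hf x y z (h ▸ hP ε α hε hPα)
  have hS : S.Nonempty := by
    obtain ⟨x, y, z, h⟩ := exists_ofCoords hρ hα
    have h1 := hpos 1 x y z isTPUnit_one (by rw [one_mul, h])
    exact ⟨(f x y z).toNat, 1, x, y, z, isTPUnit_one, by rw [one_mul, h],
      Or.inl (Int.toNat_of_nonneg h1.1.le)⟩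
  obtain ⟨ε, x, y, z, hε, h, hm⟩ := Nat.sInf_mem hS
  have hmin : ∀ ε' x' y' z', IsTPUnit ρ ε' → ε' * ofCoords ρ x y z = ofCoords ρ x' y' z' →
      ((sInf S : ℕ) : ℤ) ≤ f x' y' z' ∧ ((sInf S : ℕ) : ℤ) ≤ g x' y' z' := by
    intro ε' x' y' z' hε' h'
    have h2 : ε' * ε * α = ofCoords ρ x' y' z' := by rw [mul_assoc, h, h']
    have h1 := hpos _ x' y' z' (hε'.mul hε) h2
    constructor
    · rw [← Int.toNat_of_nonneg h1.1.le, Int.ofNat_le]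
      exact Nat.sInf_le ⟨_, x', y', z', hε'.mul hε, h2, Or.inl (Int.toNat_of_nonneg h1.1.le)⟩
    · rw [← Int.toNat_of_nonneg h1.2.le, Int.ofNat_le]
      exact Nat.sInf_le ⟨_, x', y', z', hε'.mul hε, h2, Or.inr (Int.toNat_of_nonneg h1.2.le)⟩
  refine ⟨ε, x, y, z, hε, h, ?_⟩
  rcases hm with hm | hm
  · exact Or.inl (hm ▸ hmin)
  · exact Or.inr (hm ▸ hmin)

end Coordinates

/-! ### Explicit units and reduction to cones -/

/-- The data of the root `ρ` and of the three ordered real embeddings. -/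
structure EnnolaEmbeddings {K : Type*} [Field K] (a : ℤ) (ρ : K) (σ : Fin 3 ≃ (K →+* ℝ)) :
    Prop where
  root : ρ ^ 3 + ((a : K) - 1) * ρ ^ 2 - (a : K) * ρ - 1 = 0
  roots : EnnolaRoots a (σ 0 ρ) (σ 1 ρ) (σ 2 ρ)

namespace EnnolaEmbeddings

variable {K : Type*} [Field K] {a : ℤ} {ρ : K} {σ : Fin 3 ≃ (K →+* ℝ)}

theorem ofCoords_inj (h : EnnolaEmbeddings a ρ σ) {x y z x' y' z' : ℤ}
    (e : ofCoords ρ x y z = ofCoords ρ x' y' z') : x = x' ∧ y = y' ∧ z = z' := by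
  have key : ∀ φ : K →+* ℝ, ((x - x' : ℤ) : ℝ) + ((y - y' : ℤ) : ℝ) * φ ρ
      + ((z - z' : ℤ) : ℝ) * φ ρ ^ 2 = 0 := by
    intro φ
    have := congrArg φ e
    rw [map_ofCoords, map_ofCoords] at this
    push_cast
    linear_combination this
  obtain ⟨h1, h2, h3⟩ := h.roots.eq_zero_of_forall (key (σ 0)) (key (σ 1)) (key (σ 2))
  exact ⟨sub_eq_zero.1 (Int.cast_eq_zero.1 h1), sub_eq_zero.1 (Int.cast_eq_zero.1 h2),
    sub_eq_zero.1 (Int.cast_eq_zero.1 h3)⟩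

theorem isTPUnit_add (h : EnnolaEmbeddings a ρ σ) : IsTPUnit ρ (ofCoords ρ a 1 0) := by
  refine ⟨.of_mul_eq_one (ofCoords_mem _ _ _) (ofCoords_mem 0 (-1) 1)
    (by rw [ofCoords_mul h.root, ← ofCoords_one]; congr 1 <;> ring), ?_⟩
  have h1 := h.roots.le_a_real
  rw [isTotPos_iff σ]
  simp only [map_ofCoords]
  refine ⟨?_, ?_, ?_⟩ <;> push_cast <;>
    linarith [h.roots.one_lt_p, h.roots.neg_one_lt_q, h.roots.neg_a_lt_t]

theorem isTPUnit_sub (h : EnnolaEmbeddings a ρ σ) : IsTPUnit ρ (ofCoords ρ 0 (-1) 1) :=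
  h.isTPUnit_add.of_mul_eq_one (by rw [ofCoords_mul h.root, ← ofCoords_one]; congr 1 <;> ring)

theorem isOrderUnit_root (h : EnnolaEmbeddings a ρ σ) : IsOrderUnit ρ ρ :=
  .of_mul_eq_one (Algebra.self_mem_adjoin_singleton ℤ ρ) (ofCoords_mem (-a) (a - 1) 1) (by
    simp only [ofCoords]
    push_cast
    linear_combination h.root)

theorem isTPUnit_sq (h : EnnolaEmbeddings a ρ σ) : IsTPUnit ρ (ofCoords ρ 0 0 1) := by
  have e : ofCoords ρ 0 0 1 = ρ * ρ := by simp [ofCoords, sq]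
  refine ⟨e ▸ h.isOrderUnit_root.mul h.isOrderUnit_root, fun φ => ?_⟩
  rw [e, map_mul]
  exact mul_self_pos.2 ((map_ne_zero φ).2 h.isOrderUnit_root.2.2)

/-- The end case s = a of κ_s is ρ²(ρ + a), a unit; this is why the list stops at a - 1. -/
theorem isTPUnit_kappa (h : EnnolaEmbeddings a ρ σ) : IsTPUnit ρ (ofCoords ρ 1 a 1) := by
  have e : ofCoords ρ 1 a 1 = ofCoords ρ 0 0 1 * ofCoords ρ a 1 0 := by
    rw [ofCoords_mul h.root]; congr 1 <;> ring
  exact e ▸ h.isTPUnit_sq.mul h.isTPUnit_add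

theorem kappa_mul_inv (h : EnnolaEmbeddings a ρ σ) :
    ofCoords ρ 1 a 1 * ofCoords ρ (1 + a) (1 - a) (-1) = 1 := by
  rw [ofCoords_mul h.root, ← ofCoords_one]; congr 1 <;> ring

theorem isTPUnit_kappa_inv (h : EnnolaEmbeddings a ρ σ) :
    IsTPUnit ρ (ofCoords ρ (1 + a) (1 - a) (-1)) :=
  h.isTPUnit_kappa.of_mul_eq_one h.kappa_mul_inv

/-! ### Totally positive elements -/

theorem functionals_pos (h : EnnolaEmbeddings a ρ σ) {x y z : ℤ}
    (hp : IsTotPos (ofCoords ρ x y z)) : 0 < x + z ∧ 0 < a * (x + z) - y := by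
  rw [isTotPos_iff σ] at hp
  simp only [map_ofCoords] at hp
  obtain ⟨h0, h1, h2⟩ := hp
  exact ⟨by exact_mod_cast h.roots.add_pos_of_pos h0 h1 h2,
    by exact_mod_cast h.roots.mul_sub_pos_of_pos h0 h1 h2⟩

/-- Where ρ is negative, the value is at least that of the totally positive κ_a. -/
theorem isTotPos_kappa (h : EnnolaEmbeddings a ρ σ) {s : ℤ} (hs : 0 ≤ s) (hsa : s ≤ a) :
    IsTotPos (ofCoords ρ 1 s 1) := by
  intro φ
  have h1 := h.isTPUnit_kappa.2 φ
  rw [map_ofCoords] at h1 ⊢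
  have s0 : (0 : ℝ) ≤ s := by exact_mod_cast hs
  have s1 : (s : ℝ) ≤ a := by exact_mod_cast hsa
  push_cast at h1 ⊢
  rcases le_or_gt 0 (φ ρ) with hφ | hφ
  · positivity
  · nlinarith

/-- Every totally positive element has an associate in one of two simplicial cones. -/
theorem exists_mem_cone (h : EnnolaEmbeddings a ρ σ) {α : K} (hα : α ∈ orderZ ρ)
    (hp : IsTotPos α) : ∃ ε x y z, IsTPUnit ρ ε ∧ ε * α = ofCoords ρ x y z ∧
      ((0 ≤ y ∧ y ≤ a * x ∧ y ≤ a * z) ∨ (y ≤ 0 ∧ 0 ≤ x ∧ 0 ≤ z + y)) := by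
  have ha := h.roots.le_a
  obtain ⟨ε, x, y, z, hε, e, hm⟩ := exists_minimal h.root (P := IsTotPos)
    (fun ε α hε hα => hε.2.mul hα) (fun x y z => a * (x + z) - y) (fun x _ z => a * (x + z))
    (fun x y z hp => ⟨(h.functionals_pos hp).2, mul_pos (by linarith) (h.functionals_pos hp).1⟩)
    hα hp
  refine ⟨ε, x, y, z, hε, e, ?_⟩
  rcases hm with hm | hm
  -- Each inequality compares with the facet across one edge: the second facet itself, and its
  -- multiples by ρ + a and κ_a.
  · left
    have m1 := (hm 1 x y z isTPUnit_one (one_mul _)).2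
    have m2 := (hm _ _ _ _ h.isTPUnit_sub (ofCoords_mul h.root ..)).2
    have m3 := (hm _ _ _ _ h.isTPUnit_kappa_inv (ofCoords_mul h.root ..)).2
    have pos : 0 < a ^ 2 - a - 1 := by nlinarith
    have pos' : 0 < a - 1 := by linarith
    refine ⟨by linarith, ?_, ?_⟩
    · refine le_of_mul_le_mul_left ?_ pos'
      linarith
    · refine le_of_mul_le_mul_left ?_ pos
      linarith
  · right
    have m1 := (hm 1 x y z isTPUnit_one (one_mul _)).1
    have m2 := (hm _ _ _ _ h.isTPUnit_kappa (ofCoords_mul h.root ..)).1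
    have m3 := (hm _ _ _ _ h.isTPUnit_add (ofCoords_mul h.root ..)).1
    have pos : 0 < a ^ 2 - a - 1 := by nlinarith
    have pos' : 0 < a - 1 := by linarith
    refine ⟨by linarith, ?_, ?_⟩
    · refine le_of_mul_le_mul_left ?_ pos
      linarith
    · refine le_of_mul_le_mul_left ?_ pos'
      linarith

/-! ### Elements of signature `(+, -, +)` -/

theorem mixed_functionals_pos (h : EnnolaEmbeddings a ρ σ) {x y z : ℤ}
    (hp : signature (ofCoords ρ x y z) = (![1, -1, 1] : Fin 3 → SignType) ∘ σ.symm) :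
    0 < y + z ∧ 0 < y + z - x := by
  rw [signature_eq_mixed_iff σ] at hp
  simp only [map_ofCoords] at hp
  obtain ⟨h0, h1, h2⟩ := hp
  exact ⟨by exact_mod_cast h.roots.add_pos_of_mixed h0 h1 h2,
    by exact_mod_cast h.roots.add_sub_pos_of_mixed h0 h1 h2⟩

theorem exists_mem_mixed_cone (h : EnnolaEmbeddings a ρ σ) {α : K} (hα : α ∈ orderZ ρ)
    (hp : signature α = (![1, -1, 1] : Fin 3 → SignType) ∘ σ.symm) :
    ∃ ε x y z, IsTPUnit ρ ε ∧ ε * α = ofCoords ρ x y z ∧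
      (InPentagon a (y + z) (-x - y - z) (-y + a * (x + y + z)) ∨
        (-x ≤ y + z ∧ 0 ≤ -y + z + x ∧ -y + z + x ≤ 2 * (a - 1) * (-x))) := by
  have ha := h.roots.le_a
  obtain ⟨ε, x, y, z, hε, e, hm⟩ := exists_minimal h.root
    -- The factor 2 makes both functionals equal 2 on λ_{1,0} and λ_{1,a-1}, the edge shared by
    -- pentagon and triangle.
    (P := fun α => signature α = (![1, -1, 1] : Fin 3 → SignType) ∘ σ.symm)
    (fun ε α hε hα => by rw [hε.2.signature_mul, hα])
    (fun _ y z => 2 * (y + z)) (fun x y z => y + z - x)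
    (fun x y z hp => ⟨by linarith [(h.mixed_functionals_pos hp).1],
      (h.mixed_functionals_pos hp).2⟩) hα hp
  refine ⟨ε, x, y, z, hε, e, ?_⟩
  rcases hm with hm | hm
  -- The five comparisons, `m3` being two of them, are the five sides of the pentagon.
  · left
    have m1 := (hm 1 x y z isTPUnit_one (one_mul _)).2
    have m2 := (hm _ _ _ _ h.isTPUnit_kappa_inv (ofCoords_mul h.root ..)).1
    have m3 := hm _ _ _ _ h.isTPUnit_kappa (ofCoords_mul h.root ..)
    have m4 := (hm _ _ _ _ h.isTPUnit_add (ofCoords_mul h.root ..)).2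
    refine ⟨?_, ?_, ?_, ?_, ?_⟩ <;> linarith
  · right
    have m1 := (hm 1 x y z isTPUnit_one (one_mul _)).1
    have m2 := (hm _ _ _ _ h.isTPUnit_kappa_inv (ofCoords_mul h.root ..)).1
    have m3 := (hm _ _ _ _ h.isTPUnit_sub (ofCoords_mul h.root ..)).1
    refine ⟨?_, ?_, ?_⟩ <;> linarith

end EnnolaEmbeddings

theorem IsSIndecomposable.add_absurd {K : Type*} [Field K] {ρ : K} {s : (K →+* ℝ) → SignType}
    {β γ : K} (h : IsSIndecomposable (orderZ ρ) s (β + γ)) (hβ : β ∈ orderZ ρ)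
    (hγ : γ ∈ orderZ ρ) (sβ : signature β = s) (sγ : signature γ = s) : False :=
  h.2.2 ⟨β, γ, hβ, hγ, sβ, sγ, rfl⟩

section TotallyNonnegative

variable {K : Type*} [Field K] {a : ℤ} {ρ : K}

/-- The elements of `ℤ[ρ]` that are zero or totally positive. -/
def IsTotNonneg (ρ γ : K) : Prop := γ ∈ orderZ ρ ∧ (γ = 0 ∨ IsTotPos γ)

theorem IsTotNonneg.add {β γ : K} (hβ : IsTotNonneg ρ β) (hγ : IsTotNonneg ρ γ) :
    IsTotNonneg ρ (β + γ) := by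
  refine ⟨add_mem hβ.1 hγ.1, ?_⟩
  rcases hβ.2 with rfl | h1
  · simpa using hγ.2
  · rcases hγ.2 with rfl | h2
    · exact Or.inr (by simpa using h1)
    · exact Or.inr (h1.add h2)

theorem IsTPUnit.isTotNonneg {ε : K} (h : IsTPUnit ρ ε) : IsTotNonneg ρ ε := ⟨h.1.1, Or.inr h.2⟩

theorem IsTotNonneg.intCast_mul {β : K} (hβ : IsTotNonneg ρ β) {m : ℤ} (hm : 0 ≤ m) :
    IsTotNonneg ρ (m * β) := by
  refine ⟨mul_mem (intCast_mem _ m) hβ.1, ?_⟩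
  rcases hm.eq_or_lt with rfl | hm
  · simp
  · rcases hβ.2 with rfl | h1
    · simp
    · refine Or.inr (IsTotPos.mul (fun φ => ?_) h1)
      rw [map_intCast]
      exact_mod_cast hm

/-- The products of a totally positive unit with one of the `λ_{v,w}` and `μ_u`. -/
def IsListed (a : ℤ) (ρ α : K) : Prop := ∃ ε, IsTPUnit ρ ε ∧ ∃ τ ∈ lambdasMus a ρ, α = ε * τ

theorem IsListed.mul {α ε : K} (hε : IsTPUnit ρ ε) (h : IsListed a ρ α) :
    IsListed a ρ (ε * α) := by
  obtain ⟨η, hη, τ, hτ, rfl⟩ := h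
  exact ⟨ε * η, hε.mul hη, τ, hτ, (mul_assoc ..).symm⟩

theorem IsListed.of_mul {α ε : K} (hε : IsTPUnit ρ ε) (h : IsListed a ρ (ε * α)) :
    IsListed a ρ α := by
  simpa [inv_mul_cancel_left₀ hε.1.2.2] using h.mul hε.inv

end TotallyNonnegative

/-! ### Totally positive indecomposables -/

namespace EnnolaEmbeddings

variable {K : Type*} [Field K] {a : ℤ} {ρ : K} {σ : Fin 3 ≃ (K →+* ℝ)}

section Positive

theorem eq_of_indecomposable_add {β γ : K}
    (h : IsSIndecomposable (orderZ ρ) ((![1, 1, 1] : Fin 3 → SignType) ∘ σ.symm) (β + γ))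
    (hβ : β ∈ orderZ ρ) (pβ : IsTotPos β) (hγ : IsTotNonneg ρ γ) : β + γ = β := by
  rcases hγ.2 with rfl | h1
  · exact add_zero β
  · exact (h.add_absurd hβ hγ.1 ((signature_eq_positive_iff σ).2 pβ)
      ((signature_eq_positive_iff σ).2 h1)).elim

/-- An indecomposable nonnegative combination of three totally positive units is itself a totally
positive unit. -/
theorem isTPUnit_of_indecomposable {α ε₁ ε₂ ε₃ : K} {l m n : ℤ}
    (hα : IsSIndecomposable (orderZ ρ) ((![1, 1, 1] : Fin 3 → SignType) ∘ σ.symm) α)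
    (h1 : IsTPUnit ρ ε₁) (h2 : IsTPUnit ρ ε₂) (h3 : IsTPUnit ρ ε₃)
    (hl : 0 ≤ l) (hm : 0 ≤ m) (hn : 0 ≤ n) (e : α = l * ε₁ + m * ε₂ + n * ε₃) :
    IsTPUnit ρ α := by
  have key : ∀ {ε γ : K}, IsTPUnit ρ ε → IsTotNonneg ρ γ → α = ε + γ → IsTPUnit ρ α := by
    intro ε γ hε hγ e
    have := eq_of_indecomposable_add (e ▸ hα) hε.1.1 hε.2 hγ
    rw [e, this]
    exact hε
  rcases hl.eq_or_lt with rfl | hl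
  · rcases hm.eq_or_lt with rfl | hm
    · rcases hn.eq_or_lt with rfl | hn
      · have h0 : α = 0 := by rw [e]; push_cast; ring
        have := (signature_eq_positive_iff σ).1 hα.2.1 (σ 0)
        simp [h0] at this
      · exact key h3 (h3.isTotNonneg.intCast_mul (m := n - 1) (by omega))
          (by rw [e]; push_cast; ring)
    · exact key h2 ((h2.isTotNonneg.intCast_mul (m := m - 1) (by omega)).add
        (h3.isTotNonneg.intCast_mul hn)) (by rw [e]; push_cast; ring)
  · exact key h1 ((h1.isTotNonneg.intCast_mul (m := l - 1) (by omega)).add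
      ((h2.isTotNonneg.intCast_mul hm).add (h3.isTotNonneg.intCast_mul hn)))
      (by rw [e]; push_cast; ring)

theorem exists_of_positive_indecomposable (h : EnnolaEmbeddings a ρ σ) {α : K}
    (hα : IsSIndecomposable (orderZ ρ) ((![1, 1, 1] : Fin 3 → SignType) ∘ σ.symm) α) :
    ∃ ε, IsTPUnit ρ ε ∧ ∃ τ ∈ oneKappas a ρ, α = ε * τ := by
  have ha := h.roots.le_a
  obtain ⟨ε, x, y, z, hε, e, hc⟩ :=
    h.exists_mem_cone hα.1 ((signature_eq_positive_iff σ).1 hα.2.1)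
  have hα' := hα.tp_unit_mul hε.1 hε.2
  suffices hs : IsTPUnit ρ (ε * α) ∨ ∃ s : ℤ, 1 ≤ s ∧ s ≤ a - 1 ∧ ε * α = ennolaKappa ρ s by
    rcases hs with hu | ⟨s, hs⟩
    · exact ⟨ε⁻¹ * (ε * α), hε.inv.mul hu, 1, Or.inl rfl, by
        rw [mul_one, inv_mul_cancel_left₀ hε.1.2.2]⟩
    · exact ⟨ε⁻¹, hε.inv, _, Or.inr ⟨s, hs.1, hs.2.1, rfl⟩, by
        rw [← hs.2.2, inv_mul_cancel_left₀ hε.1.2.2]⟩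
  rcases hc with ⟨hy, hx, hz⟩ | ⟨hy, hx, hz⟩
  -- The cone on 1, ρ², κ_a has index a. Removing b copies of κ_a leaves the class s; if s > 0 then
  -- x and z exceed b strictly, which leaves room for κ_s.
  · have e1 := Int.mul_ediv_add_emod y a
    have e2 := Int.emod_nonneg y (by linarith : a ≠ 0)
    have e3 := Int.emod_lt_of_pos y (by linarith : 0 < a)
    have e4 : 0 ≤ y / a := Int.ediv_nonneg hy (by linarith)
    set b := y / a
    set s := y % a
    rcases e2.eq_or_lt with hs | hs
    · left
      have b1 : 0 ≤ x - b := by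
        have : a * b ≤ a * x := by linarith
        linarith [le_of_mul_le_mul_left this (by linarith)]
      have b2 : 0 ≤ z - b := by
        have : a * b ≤ a * z := by linarith
        linarith [le_of_mul_le_mul_left this (by linarith)]
      refine isTPUnit_of_indecomposable hα' h.isTPUnit_kappa isTPUnit_one h.isTPUnit_sq e4 b1 b2 ?_
      rw [e, ← e1, ← hs]
      simp only [ofCoords]
      push_cast
      ring
    · right
      have b1 : 0 ≤ x - b - 1 := by
        have : a * b < a * x := by linarith
        linarith [lt_of_mul_lt_mul_left this (by linarith)]
      have b2 : 0 ≤ z - b - 1 := by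
        have : a * b < a * z := by linarith
        linarith [lt_of_mul_lt_mul_left this (by linarith)]
      refine ⟨s, by linarith, by linarith, ?_⟩
      have e5 : ε * α = ofCoords ρ 1 s 1 + ((b : K) * ofCoords ρ 1 a 1 + ((x - b - 1 : ℤ) : K) * 1
          + ((z - b - 1 : ℤ) : K) * ofCoords ρ 0 0 1) := by
        rw [e, ← e1]
        simp only [ofCoords]
        push_cast
        ring
      rw [ennolaKappa_eq, e5]
      exact eq_of_indecomposable_add (e5 ▸ hα') (ofCoords_mem _ _ _)
        (h.isTotPos_kappa e2 e3.le)
        (((h.isTPUnit_kappa.isTotNonneg.intCast_mul e4).add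
          (isTPUnit_one.isTotNonneg.intCast_mul b1)).add
          (h.isTPUnit_sq.isTotNonneg.intCast_mul b2))
  · left
    refine isTPUnit_of_indecomposable (l := -y) hα' h.isTPUnit_sub isTPUnit_one h.isTPUnit_sq
      (by linarith) hx hz ?_
    rw [e]
    simp only [ofCoords]
    push_cast
    ring

/-- The positive integer functional x + z equals 1 here. -/
theorem one_indecomposable (h : EnnolaEmbeddings a ρ σ) :
    IsSIndecomposable (orderZ ρ) ((![1, 1, 1] : Fin 3 → SignType) ∘ σ.symm) 1 := by
  refine ⟨one_mem _, (signature_eq_positive_iff σ).2 isTotPos_one, ?_⟩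
  rintro ⟨β, γ, hβ, hγ, sβ, sγ, e⟩
  obtain ⟨x, y, z, rfl⟩ := exists_ofCoords h.root hβ
  obtain ⟨x', y', z', rfl⟩ := exists_ofCoords h.root hγ
  rw [signature_eq_positive_iff] at sβ sγ
  rw [ofCoords_add, ← ofCoords_one] at e
  obtain ⟨e1, e2, e3⟩ := h.ofCoords_inj e
  linarith [(h.functionals_pos sβ).1, (h.functionals_pos sγ).1]

/-- On κ_s one has x + z = 2, so both summands have x + z = 1 and one has x ≥ 1. Positivity of that
summand at the root below -1 forces y ≤ 0, and then the other summand is negative at the middle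
root. -/
theorem kappa_not_decomposable (h : EnnolaEmbeddings a ρ σ) {s x y : ℤ} (hs : 1 ≤ s)
    (hx : 1 ≤ x) (h1 : IsTotPos (ofCoords ρ x y (1 - x)))
    (h2 : IsTotPos (ofCoords ρ (1 - x) (s - y) x)) : False := by
  have h1' := h1 (σ 2)
  have h2' := h2 (σ 1)
  rw [map_ofCoords] at h1' h2'
  have hr := h.roots
  have q0 := hr.q_neg
  have q1 := hr.q_gt
  have t0 := hr.t_lt
  set q := σ 1 ρ
  set t := σ 2 ρ
  have x1 : (1 : ℝ) ≤ x := by exact_mod_cast hx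
  have s1 : (1 : ℝ) ≤ s := by exact_mod_cast hs
  push_cast at h1' h2'
  have hy : y ≤ 0 := by
    by_contra! hc
    have y1 : (1 : ℝ) ≤ y := by exact_mod_cast hc
    nlinarith [mul_nonneg (by linarith : (0 : ℝ) ≤ x - 1) (by nlinarith : 0 ≤ t ^ 2 - 1)]
  have y1 : (y : ℝ) ≤ 0 := by exact_mod_cast hy
  nlinarith [mul_nonneg (by linarith : (0 : ℝ) ≤ x - 1) (by nlinarith : 0 ≤ 1 - q ^ 2),
    mul_nonneg (by linarith : (0 : ℝ) ≤ s - y - 1) (by linarith : 0 ≤ -q)]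

theorem kappa_indecomposable (h : EnnolaEmbeddings a ρ σ) {s : ℤ} (hs : 1 ≤ s)
    (hsa : s ≤ a - 1) : IsSIndecomposable (orderZ ρ)
      ((![1, 1, 1] : Fin 3 → SignType) ∘ σ.symm) (ennolaKappa ρ s) := by
  rw [ennolaKappa_eq]
  refine ⟨ofCoords_mem _ _ _, (signature_eq_positive_iff σ).2
    (h.isTotPos_kappa (by linarith) (by linarith)), ?_⟩
  rintro ⟨β, γ, hβ, hγ, sβ, sγ, e⟩
  obtain ⟨x, y, z, rfl⟩ := exists_ofCoords h.root hβ
  obtain ⟨x', y', z', rfl⟩ := exists_ofCoords h.root hγ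
  rw [signature_eq_positive_iff] at sβ sγ
  rw [ofCoords_add] at e
  obtain ⟨e1, e2, e3⟩ := h.ofCoords_inj e
  have f1 := (h.functionals_pos sβ).1
  have f2 := (h.functionals_pos sγ).1
  rcases le_or_gt 1 x with hx | hx
  · obtain rfl : z = 1 - x := by linarith
    obtain rfl : x' = 1 - x := by linarith
    obtain rfl : y' = s - y := by linarith
    obtain rfl : z' = x := by linarith
    exact h.kappa_not_decomposable hs hx sβ sγ
  · obtain rfl : z' = 1 - x' := by linarith
    obtain rfl : x = 1 - x' := by linarith
    obtain rfl : y = s - y' := by linarith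
    obtain rfl : z = x' := by linarith
    exact h.kappa_not_decomposable hs (by linarith) sγ sβ

theorem oneKappas_indecomposable (h : EnnolaEmbeddings a ρ σ) {τ : K} (hτ : τ ∈ oneKappas a ρ) :
    IsSIndecomposable (orderZ ρ) ((![1, 1, 1] : Fin 3 → SignType) ∘ σ.symm) τ := by
  rcases hτ with rfl | ⟨s, h1, h2, rfl⟩
  · exact h.one_indecomposable
  · exact h.kappa_indecomposable h1 h2

end Positive

/-! ### Indecomposables of signature (+,-,+) -/

section Mixed

theorem signature_lambda (h : EnnolaEmbeddings a ρ σ) {v w : ℤ} (hv : 1 ≤ v) (hva : v ≤ a - 1)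
    (hw : v - 1 ≤ w) (hwa : w ≤ a - 1) :
    signature (ennolaLambda a ρ v w) = (![1, -1, 1] : Fin 3 → SignType) ∘ σ.symm := by
  obtain ⟨h1, h2, h3⟩ := h.roots.lambda_signs hv hva hw hwa
  rw [signature_eq_mixed_iff, ennolaLambda_eq]
  simp only [map_ofCoords]
  push_cast
  exact ⟨by linarith, by linarith, by linarith⟩

theorem signature_mu (h : EnnolaEmbeddings a ρ σ) {u : ℤ} (hu : 0 ≤ u) (hua : u ≤ a - 2) :
    signature (ennolaMu ρ u) = (![1, -1, 1] : Fin 3 → SignType) ∘ σ.symm := by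
  obtain ⟨h1, h2, h3⟩ := h.roots.mu_signs hu hua
  rw [signature_eq_mixed_iff, ennolaMu_eq]
  simp only [map_ofCoords]
  push_cast
  exact ⟨by linarith, by linarith, by linarith⟩

/-- The point (0, 0) of the pentagon gives λ_{1,0}, which is absent from the list because w ≥ 1
there; it is an associate of a listed element. -/
theorem lambda_one_zero_eq (h : EnnolaEmbeddings a ρ σ) :
    ofCoords ρ 0 0 1 * ennolaLambda a ρ 1 0 = ennolaLambda a ρ (a - 1) (a - 1) := by
  rw [ennolaLambda_eq, ennolaLambda_eq, ofCoords_mul h.root]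
  congr 1 <;> ring

theorem isListed_lambda (h : EnnolaEmbeddings a ρ σ) {v w : ℤ} (hv : 1 ≤ v) (hva : v ≤ a - 1)
    (hw : v - 1 ≤ w) (hwa : w ≤ a - 1) : IsListed a ρ (ennolaLambda a ρ v w) := by
  have ha := h.roots.le_a
  rcases (by linarith : (0 : ℤ) ≤ w).eq_or_lt with rfl | hw0
  · obtain rfl : v = 1 := by linarith
    refine .of_mul h.isTPUnit_sq ?_
    rw [h.lambda_one_zero_eq]
    exact ⟨1, isTPUnit_one, _, Or.inl ⟨a - 1, a - 1, by linarith, le_rfl,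
      max_le (by linarith) (by linarith), le_rfl, rfl⟩, (one_mul _).symm⟩
  · exact ⟨1, isTPUnit_one, _, Or.inl ⟨v, w, hv, hva, max_le (by linarith) hw, hwa, rfl⟩,
      (one_mul _).symm⟩

/-- The element of `y + z = n` that corresponds to the point `(i, W)` of the dilated pentagon. -/
def pentagonElement (a : ℤ) (ρ : K) (n i W : ℤ) : K :=
  ofCoords ρ (-(i + n)) (-(W + a * i)) (W + a * i + n)

theorem pentagonElement_add (n i W n' i' W' : ℤ) :
    pentagonElement a ρ n i W + pentagonElement a ρ n' i' W' =
      pentagonElement a ρ (n + n') (i + i') (W + W') := by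
  simp only [pentagonElement, ofCoords_add]
  congr 1 <;> ring

/-- Points with i ≤ W are λ_{i+1,W} itself; those on the edge i = W + 1 become λ_{W+1,a-1} after
multiplication by κ_a. -/
theorem pentagonElement_one (h : EnnolaEmbeddings a ρ σ) {i W : ℤ} (hi : InPentagon a 1 i W) :
    signature (pentagonElement a ρ 1 i W) = (![1, -1, 1] : Fin 3 → SignType) ∘ σ.symm ∧
      IsListed a ρ (pentagonElement a ρ 1 i W) := by
  obtain ⟨h1, h2, h3, h4, h5⟩ := hi
  rcases le_or_gt i W with hiW | hiW
  · have e : pentagonElement a ρ 1 i W = ennolaLambda a ρ (i + 1) W := by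
      rw [ennolaLambda_eq, pentagonElement]
      congr 1 <;> ring
    rw [e]
    have hia : i + 1 ≤ a - 1 := by omega
    exact ⟨h.signature_lambda (by linarith) hia (by linarith) (by linarith),
      h.isListed_lambda (by linarith) hia (by linarith) (by linarith)⟩
  · obtain rfl : i = W + 1 := by linarith
    have e : ofCoords ρ 1 a 1 * pentagonElement a ρ 1 (W + 1) W =
        ennolaLambda a ρ (W + 1) (a - 1) := by
      rw [ennolaLambda_eq, pentagonElement, ofCoords_mul h.root]
      congr 1 <;> ring
    have hW : W + 1 ≤ a - 1 := by omega
    constructor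
    · rw [← h.isTPUnit_kappa.2.signature_mul, e]
      exact h.signature_lambda (by linarith) hW (by linarith) le_rfl
    · refine .of_mul h.isTPUnit_kappa ?_
      rw [e]
      exact h.isListed_lambda (by linarith) hW (by linarith) le_rfl

theorem signature_pentagonElement (h : EnnolaEmbeddings a ρ σ) {n : ℤ} (hn : 1 ≤ n) :
    ∀ {i W : ℤ}, InPentagon a n i W →
      signature (pentagonElement a ρ n i W) = (![1, -1, 1] : Fin 3 → SignType) ∘ σ.symm := by
  induction n, hn using Int.leInduction with
  | base => exact fun hi => (h.pentagonElement_one hi).1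
  | succ n hn ih =>
    intro i W hi
    obtain ⟨i₀, W₀, h1, h2⟩ := hi.exists_sub h.roots.le_a (by linarith)
    have s1 := (h.pentagonElement_one h1).1
    rw [add_sub_cancel_right] at h2
    have s2 := ih h2
    have e : pentagonElement a ρ (n + 1) i W =
        pentagonElement a ρ 1 i₀ W₀ + pentagonElement a ρ n (i - i₀) (W - W₀) := by
      rw [pentagonElement_add]
      congr 1 <;> ring
    rw [e, signature_add (s1.trans s2.symm), s1]

theorem isListed_of_inPentagon (h : EnnolaEmbeddings a ρ σ) {n i W : ℤ} (hn : 1 ≤ n)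
    (hi : InPentagon a n i W) (hα : IsSIndecomposable (orderZ ρ)
      ((![1, -1, 1] : Fin 3 → SignType) ∘ σ.symm) (pentagonElement a ρ n i W)) :
    IsListed a ρ (pentagonElement a ρ n i W) := by
  rcases hn.eq_or_lt with rfl | hn
  · exact (h.pentagonElement_one hi).2
  · obtain ⟨i₀, W₀, h1, h2⟩ := hi.exists_sub h.roots.le_a (by linarith)
    have e : pentagonElement a ρ n i W =
        pentagonElement a ρ 1 i₀ W₀ + pentagonElement a ρ (n - 1) (i - i₀) (W - W₀) := by
      rw [pentagonElement_add]
      congr 1 <;> ring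
    exact ((e ▸ hα).add_absurd (ofCoords_mem _ _ _) (ofCoords_mem _ _ _)
      (h.pentagonElement_one h1).1 (h.signature_pentagonElement (by linarith) h2)).elim

theorem signature_apex (h : EnnolaEmbeddings a ρ σ) {p : ℤ} (hp : 1 ≤ p) :
    signature (ofCoords ρ 0 p p) = (![1, -1, 1] : Fin 3 → SignType) ∘ σ.symm := by
  have p1 : (0 : ℝ) < p := by exact_mod_cast hp
  rw [signature_eq_mixed_iff]
  simp only [map_ofCoords, Int.cast_zero, zero_add]
  have r0 := h.roots.one_lt_p
  have r1 := h.roots.q_neg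
  have r1' := h.roots.neg_one_lt_q
  have r2 := h.roots.t_lt
  refine ⟨by positivity, ?_, ?_⟩
  · nlinarith [mul_pos p1 (mul_pos (neg_pos.2 r1) (by linarith : 0 < σ 1 ρ + 1))]
  · nlinarith [mul_pos p1 (mul_pos_of_neg_of_neg (by linarith : σ 2 ρ < 0)
      (by linarith : σ 2 ρ + 1 < 0))]

theorem isListed_apex (h : EnnolaEmbeddings a ρ σ) : IsListed a ρ (ofCoords ρ 0 1 1) := by
  have ha := h.roots.le_a
  have e : ofCoords ρ 0 1 1 = ofCoords ρ 1 a 1 * ennolaLambda a ρ 1 0 := by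
    rw [ennolaLambda_eq, ofCoords_mul h.root]
    congr 1 <;> ring
  rw [e]
  exact (h.isListed_lambda le_rfl (by linarith) le_rfl (by linarith)).mul h.isTPUnit_kappa

/-- Indecomposables in the cone over the triangle with vertices `λ_{1,0}`, `λ_{1,a-1}`,
`ρ + ρ²`. -/
theorem isListed_of_triangle (h : EnnolaEmbeddings a ρ σ) {x y z : ℤ} (h1 : -x ≤ y + z)
    (h2 : 0 ≤ -y + z + x) (h3 : -y + z + x ≤ 2 * (a - 1) * (-x))
    (hα : IsSIndecomposable (orderZ ρ)
      ((![1, -1, 1] : Fin 3 → SignType) ∘ σ.symm) (ofCoords ρ x y z)) :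
    IsListed a ρ (ofCoords ρ x y z) := by
  have ha := h.roots.le_a
  have hx : 0 ≤ -x := by
    by_contra! hc
    nlinarith
  have hv : ∀ {v W : ℤ}, 0 ≤ v → 0 ≤ W → W ≤ (a - 1) * v → InPentagon a v 0 W := by
    intro v W hv h0 h1
    have : 0 ≤ (a - 2) * v := mul_nonneg (by linarith) hv
    exact ⟨le_rfl, h0, h1, by linarith, by linarith⟩
  have hpos := (h.mixed_functionals_pos hα.2.1).1
  obtain ⟨v, rfl⟩ : ∃ v, x = -v := ⟨-x, by ring⟩
  rw [neg_neg] at h1 h3 hx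
  -- The even case consists of sums p(ρ + ρ²) plus a point on the pentagon edge i = 0 at height v;
  -- the odd points need one μ.
  rcases Int.even_or_odd' (y + z - v) with ⟨p, hp | hp⟩
  · obtain ⟨W, rfl⟩ : ∃ W, y = p - W := ⟨p - y, by ring⟩
    obtain rfl : z = p + W + v := by linarith
    have hp0 : 0 ≤ p := by linarith
    rcases hx.eq_or_lt with rfl | hx
    · obtain rfl : W = 0 := by linarith
      have e : ofCoords ρ (-0) (p - 0) (p + 0 + 0) = ofCoords ρ 0 p p := by
        congr 1 <;> ring
      rw [e] at hα ⊢
      rcases (by linarith : 1 ≤ p).eq_or_lt with rfl | hp1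
      · exact h.isListed_apex
      · have e1 : ofCoords ρ 0 p p = ofCoords ρ 0 1 1 + ofCoords ρ 0 (p - 1) (p - 1) := by
          rw [ofCoords_add]
          congr 1 <;> ring
        exact ((e1 ▸ hα).add_absurd (ofCoords_mem _ _ _) (ofCoords_mem _ _ _)
          (h.signature_apex le_rfl) (h.signature_apex (by linarith))).elim
    · have hW := hv hx.le (by linarith : 0 ≤ W) (by linarith)
      have e : ofCoords ρ (-v) (p - W) (p + W + v) =
          ofCoords ρ 0 p p + pentagonElement a ρ v 0 W := by
        rw [pentagonElement, ofCoords_add]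
        congr 1 <;> ring
      rcases hp0.eq_or_lt with rfl | hp0
      · have e1 : ofCoords ρ (-v) (0 - W) (0 + W + v) = pentagonElement a ρ v 0 W := by
          rw [pentagonElement]
          congr 1 <;> ring
        rw [e1] at hα ⊢
        exact h.isListed_of_inPentagon hx hW hα
      · exact ((e ▸ hα).add_absurd (ofCoords_mem _ _ _) (ofCoords_mem _ _ _)
          (h.signature_apex hp0) (h.signature_pentagonElement hx hW)).elim
  · obtain ⟨W, rfl⟩ : ∃ W, y = p - W := ⟨p - y, by ring⟩
    obtain rfl : z = p + W + v + 1 := by linarith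
    have hp0 : 0 ≤ p := by linarith
    have hW0 : 0 ≤ W := by omega
    -- The odd number 2W + 1 cannot reach the even bound 2(a - 1)v.
    have hW1 : W ≤ (a - 1) * v - 1 := by
      have : 2 * (a - 1) * v = 2 * ((a - 1) * v) := by ring
      omega
    have hv1 : 1 ≤ v := by
      by_contra! hc
      obtain rfl : v = 0 := by linarith
      linarith
    have hβ : signature (ofCoords ρ (-v) (-W) (W + v + 1)) =
          (![1, -1, 1] : Fin 3 → SignType) ∘ σ.symm ∧
        (IsSIndecomposable (orderZ ρ) ((![1, -1, 1] : Fin 3 → SignType) ∘ σ.symm)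
          (ofCoords ρ (-v) (-W) (W + v + 1)) →
            IsListed a ρ (ofCoords ρ (-v) (-W) (W + v + 1))) := by
      rcases hv1.eq_or_lt with rfl | hv1
      · have e : ofCoords ρ (-1) (-W) (W + 1 + 1) = ennolaMu ρ W := by
          rw [ennolaMu_eq]
          congr 1
          ring
        rw [e]
        exact ⟨h.signature_mu hW0 (by linarith), fun _ =>
          ⟨1, isTPUnit_one, _, Or.inr ⟨W, hW0, by linarith, rfl⟩, (one_mul _).symm⟩⟩
      -- The choice is u = min(W, a - 2), so that W - u still fits on the edge at height v - 1.
      · obtain ⟨u, hu0, hua, huW, hu⟩ : ∃ u, 0 ≤ u ∧ u ≤ a - 2 ∧ u ≤ W ∧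
            W - u ≤ (a - 1) * (v - 1) := by
          rcases le_or_gt W (a - 2) with hW | hW
          · exact ⟨W, hW0, hW, le_rfl, by nlinarith⟩
          · exact ⟨a - 2, by linarith, le_rfl, hW.le, by linarith⟩
        have e : ofCoords ρ (-v) (-W) (W + v + 1) =
            ennolaMu ρ u + pentagonElement a ρ (v - 1) 0 (W - u) := by
          rw [ennolaMu_eq, pentagonElement, ofCoords_add]
          congr 1 <;> ring
        have s1 := h.signature_mu hu0 hua
        have s2 := h.signature_pentagonElement (by linarith : 1 ≤ v - 1)
          (hv (by linarith) (by linarith : 0 ≤ W - u) hu)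
        rw [e]
        exact ⟨by rw [signature_add (s1.trans s2.symm), s1], fun hind =>
          (hind.add_absurd (by rw [ennolaMu_eq]; exact ofCoords_mem _ _ _)
            (ofCoords_mem _ _ _) s1 s2).elim⟩
    rcases hp0.eq_or_lt with rfl | hp0
    · have e1 : ofCoords ρ (-v) (0 - W) (0 + W + v + 1) = ofCoords ρ (-v) (-W) (W + v + 1) := by
        congr 1 <;> ring
      rw [e1] at hα ⊢
      exact hβ.2 hα
    · have e : ofCoords ρ (-v) (p - W) (p + W + v + 1) =
          ofCoords ρ 0 p p + ofCoords ρ (-v) (-W) (W + v + 1) := by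
        rw [ofCoords_add]
        congr 1 <;> ring
      exact ((e ▸ hα).add_absurd (ofCoords_mem _ _ _) (ofCoords_mem _ _ _)
        (h.signature_apex hp0) hβ.1).elim

theorem isListed_of_mixed_indecomposable (h : EnnolaEmbeddings a ρ σ) {α : K}
    (hα : IsSIndecomposable (orderZ ρ) ((![1, -1, 1] : Fin 3 → SignType) ∘ σ.symm) α) :
    IsListed a ρ α := by
  obtain ⟨ε, x, y, z, hε, e, hc⟩ := h.exists_mem_mixed_cone hα.1 hα.2.1
  refine .of_mul hε ?_
  have hα' := hα.tp_unit_mul hε.1 hε.2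
  rw [e] at hα' ⊢
  rcases hc with hc | ⟨h1, h2, h3⟩
  · have e1 : ofCoords ρ x y z =
        pentagonElement a ρ (y + z) (-x - y - z) (-y + a * (x + y + z)) := by
      rw [pentagonElement]
      congr 1 <;> ring
    have hn := (h.mixed_functionals_pos hα'.2.1).1
    rw [e1] at hα' ⊢
    exact h.isListed_of_inPentagon hn hc hα'
  · exact h.isListed_of_triangle h1 h2 h3 hα'

/-- The positive integer functional y + z equals 1 here. -/
theorem lambda_indecomposable (h : EnnolaEmbeddings a ρ σ) {v w : ℤ} (hv : 1 ≤ v)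
    (hva : v ≤ a - 1) (hw : v - 1 ≤ w) (hwa : w ≤ a - 1) :
    IsSIndecomposable (orderZ ρ) ((![1, -1, 1] : Fin 3 → SignType) ∘ σ.symm)
      (ennolaLambda a ρ v w) := by
  refine ⟨by rw [ennolaLambda_eq]; exact ofCoords_mem _ _ _,
    h.signature_lambda hv hva hw hwa, ?_⟩
  rintro ⟨β, γ, hβ, hγ, sβ, sγ, e⟩
  obtain ⟨x, y, z, rfl⟩ := exists_ofCoords h.root hβ
  obtain ⟨x', y', z', rfl⟩ := exists_ofCoords h.root hγ
  rw [ofCoords_add, ennolaLambda_eq] at e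
  obtain ⟨e1, e2, e3⟩ := h.ofCoords_inj e
  linarith [(h.mixed_functionals_pos sβ).1, (h.mixed_functionals_pos sγ).1]

/-- Written as ρ² - y(ρ² - ρ), the element is positive at the middle root if y ≤ 0 and negative at
the smallest root if y ≥ 1. -/
theorem signature_ne_mixed (h : EnnolaEmbeddings a ρ σ) (y : ℤ) :
    signature (ofCoords ρ 0 y (1 - y)) ≠ (![1, -1, 1] : Fin 3 → SignType) ∘ σ.symm := by
  intro hs
  rw [signature_eq_mixed_iff] at hs
  simp only [map_ofCoords] at hs
  obtain ⟨-, h1, h2⟩ := hs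
  have r1 := h.roots.q_neg
  have r2 := h.roots.t_lt
  push_cast at h1 h2
  rcases le_or_gt y 0 with hy | hy
  · have y0 : (y : ℝ) ≤ 0 := by exact_mod_cast hy
    nlinarith [mul_nonneg (by linarith : (0 : ℝ) ≤ -y) (by nlinarith : 0 ≤ σ 1 ρ ^ 2 - σ 1 ρ)]
  · have y0 : (1 : ℝ) ≤ y := by exact_mod_cast hy
    nlinarith [mul_nonneg (by linarith : (0 : ℝ) ≤ y - 1) (by nlinarith : 0 ≤ σ 2 ρ ^ 2 - σ 2 ρ)]

theorem mu_indecomposable (h : EnnolaEmbeddings a ρ σ) {u : ℤ} (hu : 0 ≤ u) (hua : u ≤ a - 2) :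
    IsSIndecomposable (orderZ ρ) ((![1, -1, 1] : Fin 3 → SignType) ∘ σ.symm) (ennolaMu ρ u) := by
  refine ⟨by rw [ennolaMu_eq]; exact ofCoords_mem _ _ _, h.signature_mu hu hua, ?_⟩
  rintro ⟨β, γ, hβ, hγ, sβ, sγ, e⟩
  obtain ⟨x, y, z, rfl⟩ := exists_ofCoords h.root hβ
  obtain ⟨x', y', z', rfl⟩ := exists_ofCoords h.root hγ
  rw [ofCoords_add, ennolaMu_eq] at e
  obtain ⟨e1, e2, e3⟩ := h.ofCoords_inj e
  obtain ⟨f1, f2⟩ := h.mixed_functionals_pos sβ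
  obtain ⟨f3, f4⟩ := h.mixed_functionals_pos sγ
  -- Both summands have y + z = 1, so y + z - x > 0 gives x ≤ 0 for each, while the two values of x
  -- add to -1.
  rcases (by omega : x = 0 ∨ x' = 0) with rfl | rfl
  · obtain rfl : z = 1 - y := by linarith
    exact h.signature_ne_mixed y sβ
  · obtain rfl : z' = 1 - y' := by linarith
    exact h.signature_ne_mixed y' sγ

theorem lambdasMus_indecomposable (h : EnnolaEmbeddings a ρ σ) {τ : K}
    (hτ : τ ∈ lambdasMus a ρ) :
    IsSIndecomposable (orderZ ρ) ((![1, -1, 1] : Fin 3 → SignType) ∘ σ.symm) τ := by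
  rcases hτ with ⟨v, w, h1, h2, h3, h4, rfl⟩ | ⟨u, h1, h2, rfl⟩
  · exact h.lambda_indecomposable h1 h2 ((le_max_right _ _).trans h3) h4
  · exact h.mu_indecomposable h1 h2

end Mixed

end EnnolaEmbeddings

/-! ### Irreducibility and the three real embeddings -/

section Embeddings

open Polynomial

/-- A rational root would be an integer y with y(y - 1)(y + a) = 1, hence y = ±1, and neither works.
-/
theorem not_isRoot_rat {a : ℤ} (ha : 3 ≤ a) (x : ℚ) :
    x ^ 3 + ((a : ℚ) - 1) * x ^ 2 - a * x - 1 ≠ 0 := by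
  intro h
  have hx : IsIntegral ℤ x := by
    refine ⟨X ^ 3 + C (a - 1) * X ^ 2 - C a * X - C 1, by monicity!, ?_⟩
    simpa [eval₂_eq_eval_map] using h
  obtain ⟨y, rfl⟩ := IsIntegrallyClosed.isIntegral_iff.1 hx
  have h1 : y * ((y - 1) * (y + a)) = 1 := by
    have h2 : (y : ℚ) ^ 3 + ((a : ℚ) - 1) * (y : ℚ) ^ 2 - a * (y : ℚ) - 1 = 0 := h
    have h3 : y ^ 3 + (a - 1) * y ^ 2 - a * y - 1 = 0 := by exact_mod_cast h2
    linear_combination h3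
  rcases Int.eq_one_or_neg_one_of_mul_eq_one h1 with rfl | rfl
  · simp at h1
  · linarith

variable {K : Type*} [Field K] [NumberField K] {a : ℤ} {ρ : K}

theorem minpoly_eq_ennola (ha : 3 ≤ a)
    (hρ : ρ ^ 3 + ((a : K) - 1) * ρ ^ 2 - (a : K) * ρ - 1 = 0) :
    minpoly ℚ ρ = X ^ 3 + C ((a : ℚ) - 1) * X ^ 2 - C (a : ℚ) * X - C 1 := by
  symm
  refine minpoly.eq_of_irreducible_of_monic ?_ ?_ (by monicity!)
  · have hd : (X ^ 3 + C ((a : ℚ) - 1) * X ^ 2 - C (a : ℚ) * X - C 1).natDegree = 3 := by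
      compute_degree!
    rw [irreducible_iff_roots_eq_zero_of_degree_le_three (by rw [hd]; norm_num) hd.le]
    refine Multiset.eq_zero_of_forall_notMem fun x hx => not_isRoot_rat ha x ?_
    have := isRoot_of_mem_roots hx
    simpa [IsRoot] using this
  · simpa using hρ

theorem exists_hom (ha : 3 ≤ a) (hρ : ρ ^ 3 + ((a : K) - 1) * ρ ^ 2 - (a : K) * ρ - 1 = 0)
    (hK : IntermediateField.adjoin ℚ {ρ} = ⊤) {x : ℝ}
    (hx : x ^ 3 + ((a : ℝ) - 1) * x ^ 2 - a * x - 1 = 0) : ∃ φ : K →+* ℝ, φ ρ = x := by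
  let e := (IntermediateField.algHomAdjoinIntegralEquiv ℚ (K := ℝ)
    (Algebra.IsIntegral.isIntegral (R := ℚ) ρ)).symm ⟨x, by
      rw [mem_aroots, minpoly_eq_ennola ha hρ]
      refine ⟨?_, by simpa using hx⟩
      rw [← minpoly_eq_ennola ha hρ]
      exact minpoly.ne_zero (Algebra.IsIntegral.isIntegral (R := ℚ) ρ)⟩
  let i : K →ₐ[ℚ] IntermediateField.adjoin ℚ {ρ} :=
    ((IntermediateField.equivOfEq hK).trans IntermediateField.topEquiv).symm.toAlgHom
  refine ⟨(e.comp i).toRingHom, ?_⟩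
  have h1 : i ρ = IntermediateField.AdjoinSimple.gen ℚ ρ := Subtype.ext rfl
  change e (i ρ) = x
  rw [h1]
  exact IntermediateField.algHomAdjoinIntegralEquiv_symm_apply_gen ℚ _ _

theorem ringHom_ext_of_adjoin_eq_top (hK : IntermediateField.adjoin ℚ {ρ} = ⊤)
    {φ ψ : K →+* ℝ} (h : φ ρ = ψ ρ) : φ = ψ := by
  have h1 : (φ.toRatAlgHom).comp (IntermediateField.adjoin ℚ {ρ}).val =
      (ψ.toRatAlgHom).comp (IntermediateField.adjoin ℚ {ρ}).val :=
    IntermediateField.algHom_ext_of_eq_adjoin _ rfl (by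
      intro x hx
      obtain rfl : x = ρ := hx
      exact h)
  ext x
  exact DFunLike.congr_fun h1 ⟨x, hK ▸ IntermediateField.mem_top⟩

theorem exists_ennolaEmbeddings (ha : 3 ≤ a)
    (hρ : ρ ^ 3 + ((a : K) - 1) * ρ ^ 2 - (a : K) * ρ - 1 = 0)
    (hK : IntermediateField.adjoin ℚ {ρ} = ⊤) :
    ∃ σ : Fin 3 ≃ (K →+* ℝ), EnnolaEmbeddings a ρ σ := by
  obtain ⟨p, q, t, h⟩ := exists_ennolaRoots ha
  obtain ⟨φ₀, h0⟩ := exists_hom ha hρ hK h.root_p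
  obtain ⟨φ₁, h1⟩ := exists_hom ha hρ hK h.root_q
  obtain ⟨φ₂, h2⟩ := exists_hom ha hρ hK h.root_t
  have hp := h.one_lt_p
  have hq := h.q_neg
  have hq' := h.neg_one_lt_q
  have ht := h.t_lt
  have hb : Function.Bijective ![φ₀, φ₁, φ₂] := by
    constructor
    · have hinj : Function.Injective ![p, q, t] := by
        intro i j
        fin_cases i <;> fin_cases j <;> simp <;> intro hij <;> linarith
      refine Function.Injective.of_comp (f := fun φ : K →+* ℝ => φ ρ) ?_
      convert hinj using 1
      funext i
      fin_cases i <;> simp [h0, h1, h2]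
    · intro ψ
      have hψ : (ψ ρ - p) * ((ψ ρ - q) * (ψ ρ - t)) = 0 := by
        have := congrArg ψ hρ
        simp only [map_sub, map_add, map_mul, map_pow, map_one, map_intCast, map_zero] at this
        linear_combination this - (ψ ρ) ^ 2 * h.add_add + ψ ρ * h.mul_add_mul - h.mul_mul
      rcases mul_eq_zero.1 hψ with e | e
      · exact ⟨0, ringHom_ext_of_adjoin_eq_top hK (by simp; linarith)⟩
      · rcases mul_eq_zero.1 e with e | e
        · exact ⟨1, ringHom_ext_of_adjoin_eq_top hK (by simp; linarith)⟩
        · exact ⟨2, ringHom_ext_of_adjoin_eq_top hK (by simp; linarith)⟩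
  refine ⟨Equiv.ofBijective _ hb, hρ, ?_⟩
  change EnnolaRoots a (φ₀ ρ) (φ₁ ρ) (φ₂ ρ)
  rwa [h0, h1, h2]

end Embeddings

/-! ### Signatures of units and arbitrary signatures -/

namespace EnnolaEmbeddings

variable {K : Type*} [Field K] {a : ℤ} {ρ : K} {σ : Fin 3 ≃ (K →+* ℝ)}

theorem norm_of_isOrderUnit (h : EnnolaEmbeddings a ρ σ) {x y z : ℤ}
    (hu : IsOrderUnit ρ (ofCoords ρ x y z)) :
    ennolaNorm a x y z = 1 ∨ ennolaNorm a x y z = -1 := by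
  obtain ⟨x', y', z', e⟩ := exists_ofCoords h.root hu.2.1
  have h1 : ofCoords ρ x y z * ofCoords ρ x' y' z' = 1 := by rw [← e, mul_inv_cancel₀ hu.2.2]
  have h2 : (ennolaNorm a x y z : ℝ) * ennolaNorm a x' y' z' = 1 := by
    rw [← h.roots.prod_eq_norm, ← h.roots.prod_eq_norm]
    simp only [← map_ofCoords]
    have k : ∀ φ : K →+* ℝ, φ (ofCoords ρ x y z) * φ (ofCoords ρ x' y' z') = 1 := fun φ => by
      rw [← map_mul, h1, map_one]
    calc _ = (σ 0 (ofCoords ρ x y z) * σ 0 (ofCoords ρ x' y' z')) *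
          (σ 1 (ofCoords ρ x y z) * σ 1 (ofCoords ρ x' y' z')) *
          (σ 2 (ofCoords ρ x y z) * σ 2 (ofCoords ρ x' y' z')) := by ring
      _ = 1 := by rw [k, k, k]; norm_num
  exact Int.eq_one_or_neg_one_of_mul_eq_one (by exact_mod_cast h2)

theorem not_isOrderUnit_of_mem (h : EnnolaEmbeddings a ρ σ) {τ : K} (hτ : τ ∈ lambdasMus a ρ) :
    ¬ IsOrderUnit ρ τ := by
  intro hu
  rcases hτ with ⟨v, w, h1, h2, h3, h4, rfl⟩ | ⟨u, h1, h2, rfl⟩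
  · rw [ennolaLambda_eq] at hu
    have := ennolaNorm_lambda_lt h.roots.le_a h1 h2 ((le_max_right _ _).trans h3) h4
    rcases h.norm_of_isOrderUnit hu with e | e <;> linarith
  · rw [ennolaMu_eq] at hu
    have := ennolaNorm_mu_lt h1 h2
    rcases h.norm_of_isOrderUnit hu with e | e <;> linarith

/-- Such a unit, as a multiple of the indecomposable 1, would be indecomposable, hence associated to
some λ or μ, none of which is a unit. -/
theorem unit_signature_ne_mixed (h : EnnolaEmbeddings a ρ σ) {u : K} (hu : IsOrderUnit ρ u) :
    signature u ≠ (![1, -1, 1] : Fin 3 → SignType) ∘ σ.symm := by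
  intro hs
  have h1 := h.one_indecomposable.unit_mul hu
  rw [← h.one_indecomposable.2.1, signature_one, mul_one, mul_one, hs] at h1
  obtain ⟨ε, hε, τ, hτ, rfl⟩ := h.isListed_of_mixed_indecomposable h1
  refine h.not_isOrderUnit_of_mem hτ ?_
  simpa [inv_mul_cancel_left₀ hε.1.2.2] using hε.1.inv.mul hu

theorem signature_root (h : EnnolaEmbeddings a ρ σ) :
    signature ρ = (![1, -1, -1] : Fin 3 → SignType) ∘ σ.symm := by
  have h0 : 0 < σ 0 ρ := by linarith [h.roots.one_lt_p]
  have h2 : σ 2 ρ < 0 := by linarith [h.roots.t_lt]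
  rw [signature_eq_comp_symm_iff, Fin.forall_fin_succ, Fin.forall_fin_two]
  exact ⟨sign_pos h0, sign_neg h.roots.q_neg, sign_neg h2⟩

theorem signature_neg {α : K} {s : Fin 3 → SignType} (hα : signature α = s ∘ σ.symm) :
    signature (-α) = (-s) ∘ σ.symm := by
  rw [signature_eq_comp_symm_iff] at hα ⊢
  intro i
  rw [map_neg, Left.sign_neg, hα i, Pi.neg_apply]

/-- The possible signatures of units. -/
def IsUnitSign (s : Fin 3 → SignType) : Prop :=
  s = ![1, 1, 1] ∨ s = ![-1, -1, -1] ∨ s = ![1, -1, -1] ∨ s = ![-1, 1, 1]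

theorem exists_unit_of_isUnitSign (h : EnnolaEmbeddings a ρ σ) {s : Fin 3 → SignType}
    (hs : IsUnitSign s) : ∃ η, IsOrderUnit ρ η ∧ signature η = s ∘ σ.symm := by
  have h1 : signature (1 : K) = (![1, 1, 1] : Fin 3 → SignType) ∘ σ.symm :=
    (signature_eq_positive_iff σ).2 isTotPos_one
  rcases hs with rfl | rfl | rfl | rfl
  · exact ⟨1, isOrderUnit_one, h1⟩
  · exact ⟨-1, isOrderUnit_one.neg, by rw [signature_neg h1]; simp⟩
  · exact ⟨ρ, h.isOrderUnit_root, h.signature_root⟩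
  · exact ⟨-ρ, h.isOrderUnit_root.neg, by rw [signature_neg h.signature_root]; simp⟩

theorem exists_isUnitSign_mul (s : Fin 3 → SignType) (hs : ∀ i, s i ≠ 0) :
    ∃ t, IsUnitSign t ∧ (t * s = ![1, 1, 1] ∨ t * s = ![1, -1, 1]) := by
  have key : ∀ x : SignType, x ≠ 0 → x * x = 1 := by decide
  have k2 : ∀ x : SignType, x ≠ 0 → x = 1 ∨ x = -1 := by decide
  -- Unit signatures are those whose last two entries agree, so the two outer signs can be made
  -- positive at once.
  refine ⟨![s 0, s 2, s 2], ?_, ?_⟩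
  · simp only [IsUnitSign]
    rcases k2 _ (hs 0) with e0 | e0 <;> rcases k2 _ (hs 2) with e2 | e2 <;> simp [e0, e2]
  · have e : ![s 0, s 2, s 2] * s = ![s 0 * s 0, s 2 * s 1, s 2 * s 2] := by
      funext i
      fin_cases i <;> rfl
    rw [e, key _ (hs 0), key _ (hs 2)]
    rcases k2 _ (hs 1) with e1 | e1 <;> rcases k2 _ (hs 2) with e2 | e2 <;> simp [e1, e2]

/-- Multiplication by a unit reaches one of two signatures. -/
theorem exists_unit_mul_signature (h : EnnolaEmbeddings a ρ σ) {α : K} (hα : α ≠ 0) :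
    ∃ η t, IsOrderUnit ρ η ∧ IsUnitSign t ∧ signature η = t ∘ σ.symm ∧
      (signature (η * α) = (![1, 1, 1] : Fin 3 → SignType) ∘ σ.symm ∨
        signature (η * α) = (![1, -1, 1] : Fin 3 → SignType) ∘ σ.symm) := by
  obtain ⟨t, ht, h1⟩ := exists_isUnitSign_mul (signature α ∘ σ) (fun i => by
    simpa [signature, sign_eq_zero_iff] using hα)
  obtain ⟨η, hη, e⟩ := h.exists_unit_of_isUnitSign ht
  refine ⟨η, t, hη, ht, e, ?_⟩
  have e1 : signature (η * α) = (t * (signature α ∘ σ)) ∘ σ.symm := by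
    rw [signature_mul, e]
    funext φ
    simp
  rw [e1]
  exact h1.imp (fun h => by rw [h]) (fun h => by rw [h])

/-- Some η among ±1, ±ρ brings u to (+,+,+) or (+,-,+); the latter is impossible for a unit, so u
has the signature of η. -/
theorem isUnitSign_of_unit (h : EnnolaEmbeddings a ρ σ) {u : K} (hu : IsOrderUnit ρ u)
    {t : Fin 3 → SignType} (ht : signature u = t ∘ σ.symm) : IsUnitSign t := by
  obtain ⟨η, s, hη, hs, e, h1 | h1⟩ := h.exists_unit_mul_signature hu.2.2
  · have h2 : signature u = signature η := by
      rw [signature_mul, ← (signature_eq_positive_iff σ).2 isTotPos_one, signature_one] at h1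
      have := congrArg (signature η * ·) h1
      simpa [← mul_assoc, signature_mul_self hη.2.2] using this
    rw [ht, e] at h2
    obtain rfl : t = s := σ.symm.surjective.injective_comp_right h2
    exact hs
  · exact (h.unit_signature_ne_mixed (hη.mul hu) h1).elim

theorem ne_zero_of_indecomposable {s : (K →+* ℝ) → SignType} {α : K}
    (hα : IsSIndecomposable (orderZ ρ) s α) : α ≠ 0 := by
  rintro rfl
  exact hα.2.2 ⟨0, 0, hα.1, hα.1, hα.2.1, hα.2.1, (add_zero 0).symm⟩

theorem indecomposable_iff (h : EnnolaEmbeddings a ρ σ) (s : (K →+* ℝ) → SignType) (α : K) :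
    IsSIndecomposable (orderZ ρ) s α ↔
      signature α = s ∧ ∃ ε, IsOrderUnit ρ ε ∧
        ∃ τ ∈ oneKappas a ρ ∪ lambdasMus a ρ, α = ε * τ := by
  constructor
  · intro hα
    refine ⟨hα.2.1, ?_⟩
    obtain ⟨η, t, hη, ht, e, h1⟩ := h.exists_unit_mul_signature (ne_zero_of_indecomposable hα)
    have h2 := hα.unit_mul hη
    rw [← hα.2.1, ← signature_mul] at h2
    rcases h1 with h1 | h1
    · rw [h1] at h2
      obtain ⟨ε, hε, τ, hτ, e⟩ := h.exists_of_positive_indecomposable h2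
      exact ⟨η⁻¹ * ε, hη.inv.mul hε.1, τ, Or.inl hτ, by
        rw [mul_assoc, ← e, inv_mul_cancel_left₀ hη.2.2]⟩
    · rw [h1] at h2
      obtain ⟨ε, hε, τ, hτ, e⟩ := h.isListed_of_mixed_indecomposable h2
      exact ⟨η⁻¹ * ε, hη.inv.mul hε.1, τ, Or.inr hτ, by
        rw [mul_assoc, ← e, inv_mul_cancel_left₀ hη.2.2]⟩
  · rintro ⟨rfl, ε, hε, τ, hτ, rfl⟩
    have h1 : IsSIndecomposable (orderZ ρ) (signature τ) τ := by
      rcases hτ with hτ | hτ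
      · have := h.oneKappas_indecomposable hτ
        rwa [← this.2.1] at this
      · have := h.lambdasMus_indecomposable hτ
        rwa [← this.2.1] at this
    rw [signature_mul]
    exact h1.unit_mul hε

end EnnolaEmbeddings

theorem theorem1p1 (a : ℤ) (ha : 3 ≤ a) {K : Type*} [Field K] [NumberField K] (ρ : K)
    (hρ : ρ ^ 3 + ((a : K) - 1) * ρ ^ 2 - (a : K) * ρ - 1 = 0)
    (hK : IntermediateField.adjoin ℚ {ρ} = ⊤) :
    ∃ σ : Fin 3 ≃ (K →+* ℝ),
      -- the three real embeddings, ordered so that `ρ > 1`, `-1 < ρ' < 0`, `ρ'' < -1`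
      (1 < σ 0 ρ ∧ -1 < σ 1 ρ ∧ σ 1 ρ < 0 ∧ σ 2 ρ < -1) ∧
      -- the totally positive indecomposables, up to totally positive units
      (∀ α : K,
        IsSIndecomposable (orderZ ρ) ((![1, 1, 1] : Fin 3 → SignType) ∘ σ.symm) α ↔
          ∃ ε : (orderZ ρ)ˣ, IsTotPos ((ε : orderZ ρ) : K) ∧
            ∃ τ ∈ oneKappas a ρ, α = ((ε : orderZ ρ) : K) * τ) ∧
      -- the indecomposables of signature `(+, -, +)`, up to totally positive units
      (∀ α : K,
        IsSIndecomposable (orderZ ρ) ((![1, -1, 1] : Fin 3 → SignType) ∘ σ.symm) α ↔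
          ∃ ε : (orderZ ρ)ˣ, IsTotPos ((ε : orderZ ρ) : K) ∧
            ∃ τ ∈ lambdasMus a ρ, α = ((ε : orderZ ρ) : K) * τ) ∧
      -- the indecomposables of an arbitrary signature, up to units
      (∀ (s : (K →+* ℝ) → SignType) (α : K),
        IsSIndecomposable (orderZ ρ) s α ↔
          signature α = s ∧ ∃ ε : (orderZ ρ)ˣ,
            ∃ τ ∈ oneKappas a ρ ∪ lambdasMus a ρ, α = ((ε : orderZ ρ) : K) * τ) ∧
      -- the signatures of units
      (∀ t : Fin 3 → SignType,
        (∃ ε : (orderZ ρ)ˣ, signature ((ε : orderZ ρ) : K) = t ∘ σ.symm) ↔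
          t = ![1, 1, 1] ∨ t = ![-1, -1, -1] ∨ t = ![1, -1, -1] ∨ t = ![-1, 1, 1]) ∧
      -- `(+, -, +)` is not reached from the totally positive elements through units
      (∀ (α : K) (ε : (orderZ ρ)ˣ), IsTotPos α →
        signature (((ε : orderZ ρ) : K) * α) ≠ (![1, -1, 1] : Fin 3 → SignType) ∘ σ.symm) := by
  obtain ⟨σ, h⟩ := exists_ennolaEmbeddings ha hρ hK
  refine ⟨σ, ⟨h.roots.one_lt_p, h.roots.neg_one_lt_q, h.roots.q_neg, h.roots.t_lt⟩,
    fun α => ?_, fun α => ?_, fun s α => ?_, fun t => ?_, fun α ε hα hs => ?_⟩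
  · rw [exists_units_iff (P := fun ε => IsTotPos ε ∧ ∃ τ ∈ oneKappas a ρ, α = ε * τ)]
    constructor
    · intro hα
      obtain ⟨ε, hε, hτ⟩ := h.exists_of_positive_indecomposable hα
      exact ⟨ε, hε.1, hε.2, hτ⟩
    · rintro ⟨ε, hε, hp, τ, hτ, rfl⟩
      exact (h.oneKappas_indecomposable hτ).tp_unit_mul hε hp
  · rw [exists_units_iff (P := fun ε => IsTotPos ε ∧ ∃ τ ∈ lambdasMus a ρ, α = ε * τ)]
    constructor
    · intro hα
      obtain ⟨ε, hε, hτ⟩ := h.isListed_of_mixed_indecomposable hα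
      exact ⟨ε, hε.1, hε.2, hτ⟩
    · rintro ⟨ε, hε, hp, τ, hτ, rfl⟩
      exact (h.lambdasMus_indecomposable hτ).tp_unit_mul hε hp
  · rw [exists_units_iff (P := fun ε => ∃ τ ∈ oneKappas a ρ ∪ lambdasMus a ρ, α = ε * τ)]
    exact h.indecomposable_iff s α
  · rw [exists_units_iff (P := fun ε => signature ε = t ∘ σ.symm)]
    exact ⟨fun ⟨ε, hε, hs⟩ => h.isUnitSign_of_unit hε hs, h.exists_unit_of_isUnitSign⟩
  · rw [signature_mul, isTotPos_iff_signature.1 hα, mul_one] at hs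
    exact h.unit_signature_ne_mixed (isOrderUnit_coe ε) hs
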